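/- **Setting.** Let $f:\mathbb R^d\to\mathbb R$ be differentiable, bounded below, possibly non-convex, with $L_f$-Lipschitz gradient, and $f^*=\inf f$. Let $\mathcal X$ be a measurable space; for each $\theta\in\mathbb R^d$ let $P_\theta$ be a Markov kernel on $\mathcal X$ with stationary distribution $\mu_\theta$. Let $F:\mathbb R^d\times\mathbb R^r\times\mathcal X\to\mathbb R^d$ and $G:\mathbb R^d\times\mathbb R^r\times\mathcal X\to\mathbb R^r$ be measurable in the last argument, and $\omega^*:\mathbb R^d\to\mathbb R^r$, with $$\mathbb E_{X\sim\mu_\theta}[G(\theta,\omega^*(\theta),X)]=0,\qquad \nabla f(\theta)=\mathbb E_{X\sim\mu_\theta}[F(\theta,\omega^*(\theta),X)]\quad\text{for all }\theta .$$ With $d_{TV}(\mu,\nu)=\frac12\sup_{|g|\le1}|\int g\,d\mu-\int g\,d\nu|$ and constants $B,\lambda_G,m>0$, $\rho\in(0,1)$, $L_F,L_G,L_\omega,L_{TV},L_\mu\ge0$, assume for all arguments: * $d_{TV}(P_\theta^t(x,\cdot),\mu_\theta)\le m\rho^t$ for $t\ge0$; $d_{TV}(P_\theta(x,\cdot),P_{\theta'}(x,\cdot))\le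 L_{TV}\|\theta-\theta'\|$; $d_{TV}(\mu_\theta,\mu_{\theta'})\le L_\mu\|\theta-\theta'\|$; * $F$ is $L_F$-Lipschitz and $G$ is $L_G$-Lipschitz in $(\theta,\omega)$ with respect to $\|\theta-\theta'\|+\|\omega-\omega'\|$, uniformly in $x$; $\sup_x\|G(0,0,x)\|<\infty$; $\omega^*$ is $L_\omega$-Lipschitz; $\|F\|\le B$; * $\mathbb E_{X\sim\mu_\theta}[\langle\omega-\omega^*(\theta),G(\theta,\omega,X)-G(\theta,\omega^*(\theta),X)\rangle]\le-\lambda_G\|\omega-\omega^*(\theta)\|^2$. Let $\alpha_k=c_\alpha(k+1)^{-3/5}$ and $\beta_k=c_\beta(k+1)^{-2/5}$ with $c_\alpha,c_\beta>0$. Given deterministic $\theta_0,\omega_0$, let $$\theta_{k+1}=\theta_k-\alpha_kF(\theta_k,\omega_k,X_k),\qquad \omega_{k+1}=\omega_k+\beta_kG(\theta_{k+1},\omega_k,X_k),$$ where $(X_k)$ is adapted to a filtration $(\mathcal F_k)$ and $\Pr(X_{k+1}\in\cdot\mid\mathcal F_k)=P_{\theta_{k+1}}(X_k,\cdot)$.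 Assume that $G$ is bounded by $B$ along the iterates: for every $k$, almost surely, $\|G(\theta_k,\omega_k,x)\|\le B$ and $\|G(\theta_{k+1},\omega_k,x)\|\le B$ for all $x\in\mathcal X$. Let $\tau_k=\min\{t\ge1: m\rho^t\le\alpha_k\}$ and $z_k=\omega_k-\omega^*(\theta_k)$, and put $$C_1=2BL_f+2BL_F(L_\omega+1)+2B^2L_{TV}+2B^2L_\mu,\qquad C_2=2L_GB+\tfrac{c_\alpha}{c_\beta}\left(2L_GB+2B^2L_{TV}+2B^2L_\mu\right),$$ $$C_3=\tfrac{C_2+2B}{2}+B\lambda_G(L_\omega+1)+2B^2(L_\omega+1)+2B^2,\qquad C_\nu=1-2^{-2/5}.$$ **Theorem.** The variables $\|\nabla f(\theta_k)\|^2$, $f(\theta_k)$ and $\|z_k\|^2$ are integrable for every $k$, and the following hold. 1. If $c_\alpha\le c_\beta$, then for every $k\ge\tau_k$ such that $\tau_t^2\beta_{t-\tau_t}\le\frac{\lambda_G}{C_2+2B}$ and $\beta_{t-\tau_t}\le1$ for all $\tau_k\le t\le k$, $$\begin{aligned}\min_{t\le k}\mathbb E\|\nabla f(\theta_t)\|^2\le{}&\frac{4\,\mathbb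 E[f(\theta_{\tau_k})-f^*]}{5c_\alpha C_\nu(k-\tau_k+1)^{2/5}}+\frac{6\left(4C_1B\tau_k^2+8B^2+2L_fB^2\right)c_\alpha}{C_\nu(k-\tau_k+1)^{2/5}}\\&+\frac{4L_F^2}{5c_\alpha C_\nu(k-\tau_k+1)^{2/5}}\Bigg(\frac{2c_\alpha}{\lambda_Gc_\beta}\mathbb E\|z_{\tau_k}\|^2\\&\qquad+\bigg[\Big(\frac{2L_G^2B^2}{\lambda_G^2}+\frac{2L_\omega^2B^2}{\lambda_G^2}+\frac{2L_\omega^2B^2}{\lambda_G}\Big)\frac{c_\alpha^3}{c_\beta^2}+\frac{2C_3c_\alpha c_\beta\tau_k^2}{\lambda_G}\bigg]\frac{\log(k-\tau_k+2)}{\log2}\Bigg).\end{aligned}$$ 2. For all $c_\alpha,c_\beta>0$, the conditions on $k$ in part 1 ($k\ge\tau_k$ and the step-size condition on $[\tau_k,k]$) hold for all sufficiently large $k$. 3. For all $c_\alpha,c_\beta>0$, as $k\to\infty$, $$\min_{t\le k}\mathbb E\|\nabla f(\theta_t)\|^2=O\!\left(\frac{\tau_k^2\log k}{(k-\tau_k+1)^{2/5}}\right).$$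 -/

import Mathlib

open MeasureTheory ProbabilityTheory Filter Asymptotics

noncomputable section

namespace TwoTimeScale

/-- `ℝⁿ` with the Euclidean norm. -/
abbrev E (n : ℕ) : Type := EuclideanSpace ℝ (Fin n)

/-- Total variation distance
`d_TV(μ, ν) = (1/2) sup { |∫ g dμ - ∫ g dν| : g measurable with values in [-1, 1] }`. -/
def tvDist {S : Type*} [MeasurableSpace S] (μ ν : Measure S) : ℝ :=
  (1 / 2) * sSup {a : ℝ | ∃ g : S → ℝ, Measurable g ∧ (∀ x, |g x| ≤ 1) ∧
    a = |∫ x, g x ∂μ - ∫ x, g x ∂ν|}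

/-- The constants of the problem. -/
structure Constants where
  /-- bound on the update directions -/
  B : ℝ
  /-- Lipschitz constant of `F` -/
  LF : ℝ
  /-- Lipschitz constant of `G` -/
  LG : ℝ
  /-- Lipschitz constant of `∇f` -/
  Lf : ℝ
  /-- Lipschitz constant of `ω*` -/
  Lω : ℝ
  /-- Lipschitz constant of `θ ↦ P_θ` in total variation -/
  LTV : ℝ
  /-- Lipschitz constant of `θ ↦ μ_θ` in total variation -/
  Lμ : ℝ
  /-- strong monotonicity constant of `G` -/
  lamG : ℝ
  /-- prefactor of the geometric mixing bound -/
  m : ℝ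
  /-- rate of the geometric mixing bound -/
  ρ : ℝ

/-- The constants are in their natural ranges. -/
structure Constants.Valid (c : Constants) : Prop where
  B_pos : 0 < c.B
  LF_nonneg : 0 ≤ c.LF
  LG_nonneg : 0 ≤ c.LG
  Lf_nonneg : 0 ≤ c.Lf
  Lω_nonneg : 0 ≤ c.Lω
  LTV_nonneg : 0 ≤ c.LTV
  Lμ_nonneg : 0 ≤ c.Lμ
  lamG_pos : 0 < c.lamG
  m_pos : 0 < c.m
  ρ_pos : 0 < c.ρ
  ρ_lt_one : c.ρ < 1

/-- Step size `α_k = c_α / (k+1)^{3/5}` of the decision variable. -/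
def stepα (cα : ℝ) (k : ℕ) : ℝ := cα / ((k : ℝ) + 1) ^ (3 / 5 : ℝ)

/-- Step size `β_k = c_β / (k+1)^{2/5}` of the auxiliary variable. -/
def stepβ (cβ : ℝ) (k : ℕ) : ℝ := cβ / ((k : ℝ) + 1) ^ (2 / 5 : ℝ)

/-- Mixing time `τ_k`: the least positive integer `t` with `m ρ^t ≤ α_k`. -/
def mixTime (c : Constants) (cα : ℝ) (k : ℕ) : ℕ :=
  sInf {t : ℕ | 1 ≤ t ∧ c.m * c.ρ ^ t ≤ stepα cα k}

/-- The iterates `(θ_k, ω_k)` driven by the sample path `X_0, X_1, …`: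
`θ_{k+1} = θ_k - α_k F(θ_k, ω_k, X_k)`, `ω_{k+1} = ω_k + β_k G(θ_{k+1}, ω_k, X_k)`. -/
def iterates {S : Type*} {d r : ℕ} (F : E d → E r → S → E d) (G : E d → E r → S → E r)
    (cα cβ : ℝ) (θ₀ : E d) (ω₀ : E r) (x : ℕ → S) : ℕ → E d × E r
  | 0 => (θ₀, ω₀)
  | k + 1 =>
    let p := iterates F G cα cβ θ₀ ω₀ x k
    let θ' := p.1 - stepα cα k • F p.1 p.2 (x k)
    (θ', p.2 + stepβ cβ k • G θ' p.2 (x k))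

/-- Assumptions on the problem data: objective `f`, operators `F`, `G`, transition kernels `P_θ`,
their stationary distributions `μ_θ` (written `π θ`) and the solution map `ω*`. -/
structure Assumptions {S : Type*} [MeasurableSpace S] {d r : ℕ} (c : Constants)
    (f : E d → ℝ) (F : E d → E r → S → E d) (G : E d → E r → S → E r)
    (P : E d → Kernel S S) (π : E d → Measure S) (ωstar : E d → E r) : Prop where
  -- the objective: smooth and bounded below, not necessarily convex
  f_diff : Differentiable ℝ f
  f_smooth : ∀ θ₁ θ₂, ‖gradient f θ₁ - gradient f θ₂‖ ≤ c.Lf * ‖θ₁ - θ₂‖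
  f_bdd : BddBelow (Set.range f)
  -- the Markov chains
  markov : ∀ θ, IsMarkovKernel (P θ)
  prob : ∀ θ, IsProbabilityMeasure (π θ)
  stationary : ∀ θ, Kernel.Invariant (P θ) (π θ)
  mixing : ∀ θ x (t : ℕ), tvDist ((P θ ^ t) x) (π θ) ≤ c.m * c.ρ ^ t
  P_lip : ∀ θ₁ θ₂ x, tvDist (P θ₁ x) (P θ₂ x) ≤ c.LTV * ‖θ₁ - θ₂‖
  π_lip : ∀ θ₁ θ₂, tvDist (π θ₁) (π θ₂) ≤ c.Lμ * ‖θ₁ - θ₂‖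
  -- the operators
  F_meas : ∀ θ w, Measurable (F θ w)
  G_meas : ∀ θ w, Measurable (G θ w)
  F_lip : ∀ θ₁ θ₂ w₁ w₂ x,
    ‖F θ₁ w₁ x - F θ₂ w₂ x‖ ≤ c.LF * (‖θ₁ - θ₂‖ + ‖w₁ - w₂‖)
  F_bdd : ∀ θ w x, ‖F θ w x‖ ≤ c.B
  G_lip : ∀ θ₁ θ₂ w₁ w₂ x,
    ‖G θ₁ w₁ x - G θ₂ w₂ x‖ ≤ c.LG * (‖θ₁ - θ₂‖ + ‖w₁ - w₂‖)
  G_bdd_zero : ∃ D : ℝ, ∀ x, ‖G 0 0 x‖ ≤ D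
  -- `ω*(θ)` solves `E_{X ∼ μ_θ}[G(θ, ω*(θ), X)] = 0`
  ωstar_eq : ∀ θ, ∫ x, G θ (ωstar θ) x ∂(π θ) = 0
  ωstar_lip : ∀ θ₁ θ₂, ‖ωstar θ₁ - ωstar θ₂‖ ≤ c.Lω * ‖θ₁ - θ₂‖
  G_mono : ∀ θ w, ∫ x, inner ℝ (w - ωstar θ) (G θ w x - G θ (ωstar θ) x) ∂(π θ)
    ≤ -c.lamG * ‖w - ωstar θ‖ ^ 2
  -- `∇f(θ) = E_{X ∼ μ_θ}[F(θ, ω*(θ), X)]`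
  grad_eq : ∀ θ, gradient f θ = ∫ x, F θ (ωstar θ) x ∂(π θ)

/-- `X` is the time-varying Markov chain controlled by the decision iterates `θ`:
given the past up to time `k`, the state `X_{k+1}` has law `P_{θ_{k+1}}(X_k, ·)`. -/
structure IsControlledChain {S Ω : Type*} [MeasurableSpace S] {mΩ : MeasurableSpace Ω} {d : ℕ}
    (P : E d → Kernel S S) (Pr : Measure Ω) (ℱ : Filtration ℕ mΩ)
    (X : ℕ → Ω → S) (θ : ℕ → Ω → E d) : Prop where
  adapted : ∀ k, Measurable[ℱ k] (X k)
  transition : ∀ k (A : Set S), MeasurableSet A →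
    Pr[(X (k + 1) ⁻¹' A).indicator (fun _ => (1 : ℝ)) | ℱ k]
      =ᵐ[Pr] fun o => (P (θ (k + 1) o) (X k o)).real A

/-- `C_ν = 1 - 1 / 2^{1-ν}` with `ν = 3/5`. -/
def Cν : ℝ := 1 - 1 / (2 : ℝ) ^ (2 / 5 : ℝ)

def C₁ (c : Constants) : ℝ :=
  2 * c.B * c.Lf + 2 * c.B * c.LF * (c.Lω + 1) + 2 * c.B ^ 2 * c.LTV + 2 * c.B ^ 2 * c.Lμ

def C₂ (c : Constants) (cα cβ : ℝ) : ℝ :=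
  2 * c.LG * c.B + 2 * c.LG * c.B * cα / cβ + 2 * c.B ^ 2 * c.LTV * cα / cβ
    + 2 * c.B ^ 2 * c.Lμ * cα / cβ

def C₃ (c : Constants) (cα cβ : ℝ) : ℝ :=
  (C₂ c cα cβ + 2 * c.B) / 2 + c.B * c.lamG * (c.Lω + 1) + 2 * c.B ^ 2 * (c.Lω + 1)
    + 2 * c.B ^ 2

/-- The step-size condition at time `t`:
`τ_t² β_{t-τ_t} ≤ λ_G / (C₂ + 2B)` and `β_{t-τ_t} ≤ 1`. -/
def StepCondition (c : Constants) (cα cβ : ℝ) (t : ℕ) : Prop :=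
  (mixTime c cα t : ℝ) ^ 2 * stepβ cβ (t - mixTime c cα t) ≤ c.lamG / (C₂ c cα cβ + 2 * c.B) ∧
    stepβ cβ (t - mixTime c cα t) ≤ 1

/-- `min_{t ≤ k} a_t`. -/
def minUpTo (a : ℕ → ℝ) (k : ℕ) : ℝ :=
  (Finset.range (k + 1)).inf' Finset.nonempty_range_add_one a

/-- The explicit upper bound at time `k`; `N = k - τ_k + 1`, `gap = E[f(θ_{τ_k}) - f*]` and
`err = E[‖ω_{τ_k} - ω*(θ_{τ_k})‖²]`. -/
def explicitBound (c : Constants) (cα cβ : ℝ) (τ N gap err : ℝ) : ℝ :=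
  4 / (5 * cα * Cν * N ^ (2 / 5 : ℝ)) * gap
  + 4 * c.LF ^ 2 / (5 * cα * Cν * N ^ (2 / 5 : ℝ)) *
    (2 * cα / (c.lamG * cβ) * err
      + ((2 * c.LG ^ 2 * c.B ^ 2 / c.lamG ^ 2 + 2 * c.Lω ^ 2 * c.B ^ 2 / c.lamG ^ 2
            + 2 * c.Lω ^ 2 * c.B ^ 2 / c.lamG) * (cα ^ 3 / cβ ^ 2)
          + 2 * C₃ c cα cβ * cα * cβ / c.lamG * τ ^ 2)
        * (Real.log (N + 1) / Real.log 2))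
  + 6 * (4 * C₁ c * c.B * τ ^ 2 + 8 * c.B ^ 2 + 2 * c.Lf * c.B ^ 2) * cα
    / (Cν * N ^ (2 / 5 : ℝ))

end TwoTimeScale

end

/-!
The proof is a Lyapunov argument for two coupled drifts, with the Markovian noise removed by looking
back one mixing time. Below `z_t = ω_t - ω*(θ_t)` is the tracking error and `s = t - τ_t`.

*Markovian noise.* For a bounded function `H p` of the state that depends on a quantity `p` known at
time `s`, the expectation of `H p` at `X_{s+τ}` is compared with the one for the chain whose
parameter is frozen at `θ_s`, exchanging one transition at a time. Each exchange costs a total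
variation distance `≤ LTV * ‖θ_{s+i} - θ_s‖`, and `τ` steps of the frozen chain bring it within
`m ρ ^ τ ≤ α` of the stationary law; this is `abs_integral_sub_stationary_le`. It needs only the
conditional law of the next state (`map_prodMk_eq_compProd`), so the state space may be an arbitrary
measurable space. As the iterates move slowly, the bias of the sampled directions is of order
`τ² α_s` for the gradient (`abs_gradientNoise_le`) and `τ β_s + τ² β_s E‖z_s‖` for the tracking error
(`trackingNoise_le`).

*Tracking error.* Strong monotonicity contracts `E‖z_t‖²` by `1 - 2 λ β_t`. The motion of the target
`ω*(θ_t)` and the noise are linear in `‖z_t‖`, and Young's inequality lets each of them use half of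
`λ β_t`, where the step-size condition bounds the coefficient of the noise by `λ` (`drift_z`).
Multiplying by `α_t / (λ β_t)`, which is nonincreasing, and summing by parts turns this into a bound
on `∑ α_t E‖z_t‖²` of logarithmic order (`sum_z_le`).

*Objective.* Smoothness of `f` gives the drift inequality for `E f(θ_t)` and hence a bound on
`∑ α_t E‖∇f(θ_t)‖²` in terms of the initial gap and the previous sum (`sum_gradient_le`). Dividing by
`∑ α_t` bounds the smallest gradient (`minUpTo_mul_le`).

The sum of the step sizes over the `N` times in `[τ_k, k]` is of order `N ^ (2/5)` only if `N` exceeds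
`τ_k`. For shorter windows the explicit bound holds for a different reason: one gradient step bounds
the gap from below by a multiple of `E‖∇f(θ_{τ_k})‖²`, and if `Lf` is too large for that, the term with
`C₁` exceeds the trivial bound `B ^ 2` (`integral_gradient_le_explicitBound`).
-/

namespace TwoTimeScale

/-! ### Smooth functions -/

/-- The quadratic upper bound for a function with Lipschitz gradient: along the segment from `x` to
`x + v` the difference of the two sides is monotone. -/
theorem le_quadratic_of_gradient_lipschitz {n : ℕ} {f : E n → ℝ} {L : ℝ}
    (hd : Differentiable ℝ f)
    (hL : ∀ x y, ‖gradient f x - gradient f y‖ ≤ L * ‖x - y‖) (x v : E n) :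
    f (x + v) ≤ f x + inner ℝ (gradient f x) v + L / 2 * ‖v‖ ^ 2 := by
  set φ : ℝ → ℝ := fun t => f (x + t • v) - t * inner ℝ (gradient f x) v - L / 2 * t ^ 2 * ‖v‖ ^ 2
    with hφ
  have hder : ∀ t, HasDerivAt φ (inner ℝ (gradient f (x + t • v)) v - inner ℝ (gradient f x) v
      - L * t * ‖v‖ ^ 2) t := by
    intro t
    have h1 : HasDerivAt (fun t : ℝ => x + t • v) v t := by
      simpa using ((hasDerivAt_id t).smul_const v).const_add x
    have h2 := (hd (x + t • v)).hasGradientAt.hasFDerivAt.comp_hasDerivAt t h1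
    have h3 := (h2.sub ((hasDerivAt_id t).mul_const (inner ℝ (gradient f x) v))).sub
      ((((hasDerivAt_id t).pow 2).const_mul (L / 2)).mul_const (‖v‖ ^ 2))
    refine h3.congr_deriv ?_
    simp only [InnerProductSpace.toDual_apply_apply, id]
    push_cast
    ring
  have hanti : AntitoneOn φ (Set.Icc 0 1) := by
    refine antitoneOn_of_deriv_nonpos (convex_Icc 0 1)
      (fun t _ => (hder t).continuousAt.continuousWithinAt)
      (fun t _ => (hder t).differentiableAt.differentiableWithinAt) ?_
    intro t ht
    rw [interior_Icc] at ht
    rw [(hder t).deriv, ← inner_sub_left]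
    have h1 := real_inner_le_norm (gradient f (x + t • v) - gradient f x) v
    have h2 := hL (x + t • v) x
    have h3 : ‖x + t • v - x‖ = t * ‖v‖ := by
      rw [add_sub_cancel_left, norm_smul, Real.norm_of_nonneg ht.1.le]
    rw [h3] at h2
    nlinarith [mul_le_mul_of_nonneg_right h2 (norm_nonneg v)]
  have h01 := hanti (Set.left_mem_Icc.2 zero_le_one) (Set.right_mem_Icc.2 zero_le_one) zero_le_one
  simp only [hφ, zero_smul, add_zero, one_smul] at h01
  linarith

/-- A gradient step of length `s` bounds the optimality gap from below by the gradient. -/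
theorem mul_norm_gradient_sq_le_gap {n : ℕ} {f : E n → ℝ} {L : ℝ}
    (hd : Differentiable ℝ f) (hb : BddBelow (Set.range f))
    (hL : ∀ x y, ‖gradient f x - gradient f y‖ ≤ L * ‖x - y‖) (x : E n) (s : ℝ) :
    s * (1 - L * s / 2) * ‖gradient f x‖ ^ 2 ≤ f x - ⨅ u, f u := by
  have h := le_quadratic_of_gradient_lipschitz hd hL x (-(s • gradient f x))
  rw [inner_neg_right, inner_smul_right, real_inner_self_eq_norm_sq, norm_neg, norm_smul, mul_pow,
    Real.norm_eq_abs, sq_abs] at h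
  have h2 := ciInf_le hb (x + -(s • gradient f x))
  linarith

/-- A differentiable function whose gradient is bounded by `B` is `B`-Lipschitz. -/
theorem abs_sub_le_of_norm_gradient_le {n : ℕ} {f : E n → ℝ} {B : ℝ} (hd : Differentiable ℝ f)
    (hB : ∀ x, ‖gradient f x‖ ≤ B) (x y : E n) : |f x - f y| ≤ B * ‖x - y‖ := by
  refine convex_univ.norm_image_sub_le_of_norm_fderiv_le (𝕜 := ℝ) (fun z _ => hd z)
    (fun z _ => ?_) (Set.mem_univ y) (Set.mem_univ x)
  have := hB z
  rwa [gradient, LinearIsometryEquiv.norm_map] at this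

/-! ### Sums of powers -/

theorem sum_inv_le_log_div_log_two (N : ℕ) :
    ∑ j ∈ Finset.range N, 1 / ((j : ℝ) + 1) ≤ Real.log ((N : ℝ) + 1) / Real.log 2 := by
  have hl2 : 0 < Real.log 2 := Real.log_pos (by norm_num)
  rw [le_div_iff₀ hl2]
  induction N with
  | zero => simp
  | succ n ih =>
    rw [Finset.sum_range_succ, add_mul]
    have hn : (0 : ℝ) < (n : ℝ) + 1 := by positivity
    -- Bernoulli: `2 ^ x ≤ 1 + x` for `x ∈ [0, 1]`
    have hb : (2 : ℝ) ^ (1 / ((n : ℝ) + 1)) ≤ 1 + 1 / ((n : ℝ) + 1) := by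
      have h1 : 1 / ((n : ℝ) + 1) ≤ 1 := by
        rw [div_le_one hn]; linarith [(Nat.cast_nonneg n : (0 : ℝ) ≤ n)]
      have := rpow_one_add_le_one_add_mul_self (s := 1) (by norm_num)
        (p := 1 / ((n : ℝ) + 1)) (by positivity) h1
      norm_num at this ⊢
      exact this
    have h2 : 1 / ((n : ℝ) + 1) * Real.log 2 ≤ Real.log (1 + 1 / ((n : ℝ) + 1)) := by
      rw [← Real.log_rpow (by norm_num)]
      exact Real.log_le_log (by positivity) hb
    have h3 : Real.log (((n + 1 : ℕ) : ℝ) + 1)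
        = Real.log ((n : ℝ) + 1) + Real.log (1 + 1 / ((n : ℝ) + 1)) := by
      rw [← Real.log_mul hn.ne' (by positivity)]
      congr 1
      push_cast
      field_simp
    rw [h3]
    linarith

theorem sum_rpow_neg_le (N : ℕ) :
    ∑ j ∈ Finset.range N, ((j : ℝ) + 1) ^ (-(6 / 5) : ℝ) ≤ 6 := by
  -- comparison with the integral of `x ^ (-6/5)`; the step is Bernoulli's inequality
  have key : ∀ n : ℕ, ∑ j ∈ Finset.range (n + 1), ((j : ℝ) + 1) ^ (-(6 / 5) : ℝ)
      ≤ 6 - 5 * ((n : ℝ) + 1) ^ (-(1 / 5) : ℝ) := by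
    intro n
    induction n with
    | zero => simp; norm_num
    | succ n ih =>
      rw [Finset.sum_range_succ]
      have hn : (0 : ℝ) < (n : ℝ) + 1 := by positivity
      set y : ℝ := (n : ℝ) + 1 + 1 with hy
      have hy0 : 0 < y := by positivity
      have hy1 : 1 / y ≤ 1 := by rw [div_le_one hy0]; linarith
      have e1 : (n : ℝ) + 1 = y * (1 + -(1 / y)) := by field_simp; rw [hy]; ring
      have hb := rpow_one_add_le_one_add_mul_self (s := -(1 / y)) (by linarith)
        (p := 1 / 5) (by norm_num) (by norm_num)
      have hpos : 0 < 1 + -(1 / y) := by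
        have : 1 / y < 1 := by rw [div_lt_one hy0]; linarith
        linarith
      have hpp : 0 < (1 + -(1 / y)) ^ (1 / 5 : ℝ) := Real.rpow_pos_of_pos hpos _
      have h2 : 1 + 1 / 5 * (1 / y) ≤ (1 + -(1 / y)) ^ (-(1 / 5) : ℝ) := by
        rw [Real.rpow_neg hpos.le, le_inv_comm₀ (by positivity) hpp]
        refine hb.trans ?_
        rw [le_inv_comm₀ (by nlinarith) (by positivity), ← one_div,
          le_div_iff₀ (by nlinarith)]
        nlinarith [sq_nonneg (1 / y)]
      have h3 : ((n : ℝ) + 1) ^ (-(1 / 5) : ℝ)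
          = y ^ (-(1 / 5) : ℝ) * (1 + -(1 / y)) ^ (-(1 / 5) : ℝ) := by
        rw [← Real.mul_rpow hy0.le hpos.le, ← e1]
      have h4 : y ^ (-(6 / 5) : ℝ) = y ^ (-(1 / 5) : ℝ) * (1 / y) := by
        rw [one_div y, ← Real.rpow_neg_one y, ← Real.rpow_add hy0]; norm_num
      have hyp : 0 < y ^ (-(1 / 5) : ℝ) := Real.rpow_pos_of_pos hy0 _
      push_cast
      rw [← hy, h4]
      rw [h3] at ih
      nlinarith [mul_le_mul_of_nonneg_left h2 hyp.le]
  cases N with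
  | zero => simp
  | succ n =>
    have : 0 < ((n : ℝ) + 1) ^ (-(1 / 5) : ℝ) := Real.rpow_pos_of_pos (by positivity) _
    linarith [key n]

/-- Lower integral bound for a sum of `x ^ (-3/5)`. -/
theorem rpow_sub_rpow_le_sum (a N : ℕ) :
    5 / 2 * (((a : ℝ) + N + 1) ^ (2 / 5 : ℝ) - ((a : ℝ) + 1) ^ (2 / 5 : ℝ))
      ≤ ∑ j ∈ Finset.range N, 1 / ((((a + j : ℕ)) : ℝ) + 1) ^ (3 / 5 : ℝ) := by
  induction N with
  | zero => simp
  | succ n ih =>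
    rw [Finset.sum_range_succ]
    set y : ℝ := (a : ℝ) + n + 1 with hy
    have hy0 : 0 < y := by positivity
    have hb := rpow_one_add_le_one_add_mul_self (s := 1 / y)
      (by linarith [(by positivity : 0 < 1 / y)]) (p := 2 / 5) (by norm_num) (by norm_num)
    have e1 : (a : ℝ) + ((n + 1 : ℕ) : ℝ) + 1 = y * (1 + 1 / y) := by
      field_simp; push_cast; rw [hy]; ring
    have e2 : (((a + n : ℕ)) : ℝ) + 1 = y := by push_cast; rw [hy]
    have hyp : 0 < y ^ (2 / 5 : ℝ) := Real.rpow_pos_of_pos hy0 _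
    have e3 : 1 / y ^ (3 / 5 : ℝ) = y ^ (2 / 5 : ℝ) * (1 / y) := by
      rw [one_div, one_div, ← Real.rpow_neg_one y, ← Real.rpow_add hy0, ← Real.rpow_neg hy0.le]
      norm_num
    rw [e1, e2, e3, Real.mul_rpow hy0.le (by positivity)]
    nlinarith [mul_le_mul_of_nonneg_left hb hyp.le]

/-! ### Step sizes and mixing time -/

theorem stepα_pos {a : ℝ} (ha : 0 < a) (k : ℕ) : 0 < stepα a k := by
  unfold stepα; positivity

theorem stepβ_pos {b : ℝ} (hb : 0 < b) (k : ℕ) : 0 < stepβ b k := by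
  unfold stepβ; positivity

theorem stepα_antitone {a : ℝ} (ha : 0 < a) : Antitone (stepα a) := by
  intro i j hij
  have : (i : ℝ) ≤ j := by exact_mod_cast hij
  unfold stepα
  gcongr

theorem stepβ_antitone {b : ℝ} (hb : 0 < b) : Antitone (stepβ b) := by
  intro i j hij
  have : (i : ℝ) ≤ j := by exact_mod_cast hij
  unfold stepβ
  gcongr

theorem stepα_le_stepβ {a b : ℝ} (ha : 0 < a) (hb : 0 < b) (k : ℕ) :
    stepα a k ≤ a / b * stepβ b k := by
  unfold stepα stepβ
  rw [div_mul_div_comm, mul_comm b, mul_div_mul_right _ _ hb.ne']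
  exact div_le_div_of_nonneg_left ha.le (by positivity)
    (Real.rpow_le_rpow_of_exponent_le (by linarith [(Nat.cast_nonneg k : (0 : ℝ) ≤ k)])
      (by norm_num))

theorem stepα_div_stepβ {a b : ℝ} (k : ℕ) :
    stepα a k / stepβ b k = a / b * ((k : ℝ) + 1) ^ (-(1 / 5) : ℝ) := by
  have hk : (0 : ℝ) < (k : ℝ) + 1 := by positivity
  have e : ((k : ℝ) + 1) ^ (-(1 / 5) : ℝ)
      = ((k : ℝ) + 1) ^ (2 / 5 : ℝ) / ((k : ℝ) + 1) ^ (3 / 5 : ℝ) := by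
    rw [← Real.rpow_sub hk]; norm_num
  unfold stepα stepβ
  rw [e, div_div_div_eq, div_mul_div_comm, mul_comm b]

theorem stepα_div_stepβ_antitone {a b : ℝ} (ha : 0 < a) (hb : 0 < b) :
    Antitone fun k => stepα a k / stepβ b k := by
  intro i j hij
  have : (i : ℝ) ≤ j := by exact_mod_cast hij
  simp only [stepα_div_stepβ]
  exact mul_le_mul_of_nonneg_left
    (Real.rpow_le_rpow_of_nonpos (by positivity) (by linarith) (by norm_num)) (by positivity)

theorem stepα_mul_stepβ {a b : ℝ} (k : ℕ) :
    stepα a k * stepβ b k = a * b * (1 / ((k : ℝ) + 1)) := by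
  have hk : (0 : ℝ) < (k : ℝ) + 1 := by positivity
  unfold stepα stepβ
  rw [div_mul_div_comm, ← Real.rpow_add hk]
  norm_num
  rfl

theorem stepα_pow_div_stepβ_pow {a b : ℝ} (k : ℕ) :
    stepα a k ^ 3 / stepβ b k ^ 2 = a ^ 3 / b ^ 2 * (1 / ((k : ℝ) + 1)) := by
  have hk : (0 : ℝ) < (k : ℝ) + 1 := by positivity
  have e : 1 / ((k : ℝ) + 1)
      = (((k : ℝ) + 1) ^ (2 / 5 : ℝ)) ^ 2 / (((k : ℝ) + 1) ^ (3 / 5 : ℝ)) ^ 3 := by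
    rw [← Real.rpow_natCast, ← Real.rpow_natCast, ← Real.rpow_mul hk.le, ← Real.rpow_mul hk.le,
      ← Real.rpow_sub hk, one_div, ← Real.rpow_neg_one]
    norm_num
  unfold stepα stepβ
  rw [e, div_pow, div_pow, div_div_div_eq, div_mul_div_comm, mul_comm (b ^ 2)]

theorem stepα_sq {a : ℝ} (k : ℕ) :
    stepα a k ^ 2 = a ^ 2 * ((k : ℝ) + 1) ^ (-(6 / 5) : ℝ) := by
  have hk : (0 : ℝ) < (k : ℝ) + 1 := by positivity
  unfold stepα
  rw [div_pow, ← Real.rpow_natCast (_ ^ _) 2, ← Real.rpow_mul hk.le, Real.rpow_neg hk.le,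
    div_eq_mul_inv]
  norm_num

theorem tendsto_stepα (a : ℝ) : Tendsto (stepα a) atTop (nhds 0) := by
  have h : Tendsto (fun k : ℕ => ((k : ℝ) + 1) ^ (3 / 5 : ℝ)) atTop atTop :=
    (tendsto_rpow_atTop (by norm_num)).comp
      (tendsto_atTop_add_const_right _ _ tendsto_natCast_atTop_atTop)
  exact h.const_div_atTop a

theorem mixTime_spec {c : Constants} (hc : c.Valid) {a : ℝ} (ha : 0 < a) (k : ℕ) :
    1 ≤ mixTime c a k ∧ c.m * c.ρ ^ mixTime c a k ≤ stepα a k := by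
  have hne : {t : ℕ | 1 ≤ t ∧ c.m * c.ρ ^ t ≤ stepα a k}.Nonempty := by
    have h0 : Tendsto (fun t : ℕ => c.m * c.ρ ^ t) atTop (nhds 0) := by
      simpa using (tendsto_pow_atTop_nhds_zero_of_lt_one hc.ρ_pos.le hc.ρ_lt_one).const_mul c.m
    obtain ⟨t, ht⟩ := ((h0.eventually (gt_mem_nhds (stepα_pos ha k))).and
      (eventually_ge_atTop 1)).exists
    exact ⟨t, ht.2, ht.1.le⟩
  exact Nat.sInf_mem hne

theorem mixTime_le {c : Constants} {a : ℝ} {k t : ℕ} (ht : 1 ≤ t)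
    (h : c.m * c.ρ ^ t ≤ stepα a k) : mixTime c a k ≤ t :=
  Nat.sInf_le ⟨ht, h⟩

theorem mixTime_mono {c : Constants} (hc : c.Valid) {a : ℝ} (ha : 0 < a) :
    Monotone (mixTime c a) := by
  intro i j hij
  have h := mixTime_spec hc ha j
  exact mixTime_le h.1 (h.2.trans (stepα_antitone ha hij))

/-! ### Minima and weighted sums -/

theorem minUpTo_le (a : ℕ → ℝ) {t k : ℕ} (h : t ≤ k) : minUpTo a k ≤ a t :=
  Finset.inf'_le _ (Finset.mem_range.2 (Nat.lt_succ_of_le h))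

theorem minUpTo_nonneg {a : ℕ → ℝ} (ha : ∀ t, 0 ≤ a t) (k : ℕ) : 0 ≤ minUpTo a k :=
  Finset.le_inf' _ _ fun t _ => ha t

/-- Abel summation: a weighted telescoping sum with nonincreasing nonnegative weights. -/
theorem sum_mul_sub_le {w V : ℕ → ℝ} (hw : Antitone w) (hw0 : ∀ n, 0 ≤ w n) (hV : ∀ n, 0 ≤ V n)
    (a N : ℕ) :
    ∑ j ∈ Finset.range N, w (a + j) * (V (a + j) - V (a + j + 1)) ≤ w a * V a := by
  have key : ∑ j ∈ Finset.range N, w (a + j) * (V (a + j) - V (a + j + 1))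
      ≤ w a * V a - w (a + N) * V (a + N) := by
    induction N with
    | zero => simp
    | succ n ih =>
      rw [Finset.sum_range_succ, ← add_assoc]
      nlinarith [mul_le_mul_of_nonneg_right (hw (Nat.le_succ (a + n))) (hV (a + n + 1))]
  linarith [mul_nonneg (hw0 (a + N)) (hV (a + N))]

/-- Over a window longer than its starting time, `n + 1 ≤ (n + N + 1) / 2`; this is where the factor
`Cν = 1 - 2 ^ (-2/5)` comes from. -/
theorem sum_stepα_ge {a : ℝ} (ha : 0 < a) {n N : ℕ} (hN : n + 1 ≤ N) :
    5 / 2 * a * Cν * (N : ℝ) ^ (2 / 5 : ℝ) ≤ ∑ j ∈ Finset.range N, stepα a (n + j) := by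
  have h1 := rpow_sub_rpow_le_sum n N
  have hN' : (n : ℝ) + 1 ≤ N := by exact_mod_cast hN
  have hn : (0 : ℝ) ≤ n := Nat.cast_nonneg n
  set M : ℝ := (n : ℝ) + N + 1 with hM
  have hM0 : 0 < M := by positivity
  have h2 : ((n : ℝ) + 1) ^ (2 / 5 : ℝ) ≤ (M / 2) ^ (2 / 5 : ℝ) :=
    Real.rpow_le_rpow (by positivity) (by linarith) (by norm_num)
  rw [Real.div_rpow hM0.le (by norm_num)] at h2
  have h3 : (N : ℝ) ^ (2 / 5 : ℝ) ≤ M ^ (2 / 5 : ℝ) :=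
    Real.rpow_le_rpow (by positivity) (by linarith) (by norm_num)
  have hC : 0 ≤ Cν := by
    have : (1 : ℝ) ≤ 2 ^ (2 / 5 : ℝ) := Real.one_le_rpow (by norm_num) (by norm_num)
    unfold Cν
    rw [sub_nonneg, div_le_one (by positivity)]
    exact this
  have h4 : Cν * (N : ℝ) ^ (2 / 5 : ℝ) ≤ M ^ (2 / 5 : ℝ) - ((n : ℝ) + 1) ^ (2 / 5 : ℝ) := by
    refine (mul_le_mul_of_nonneg_left h3 hC).trans ?_
    have : Cν * M ^ (2 / 5 : ℝ) = M ^ (2 / 5 : ℝ) - M ^ (2 / 5 : ℝ) / 2 ^ (2 / 5 : ℝ) := by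
      unfold Cν; ring
    linarith
  have h5 : ∑ j ∈ Finset.range N, stepα a (n + j)
      = a * ∑ j ∈ Finset.range N, 1 / ((((n + j : ℕ)) : ℝ) + 1) ^ (3 / 5 : ℝ) := by
    rw [Finset.mul_sum]
    refine Finset.sum_congr rfl fun j _ => ?_
    unfold stepα
    rw [mul_one_div]
  rw [h5]
  have h6 := mul_le_mul_of_nonneg_left h4 (by positivity : 0 ≤ 5 / 2 * a)
  have h7 := mul_le_mul_of_nonneg_left h1 ha.le
  linarith

theorem minUpTo_mul_sum_le {g w : ℕ → ℝ} (hw : ∀ t, 0 ≤ w t) {a N k : ℕ} (hk : a + N ≤ k + 1) :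
    minUpTo g k * ∑ j ∈ Finset.range N, w (a + j)
      ≤ ∑ j ∈ Finset.range N, w (a + j) * g (a + j) := by
  rw [Finset.mul_sum]
  refine Finset.sum_le_sum fun j hj => ?_
  rw [mul_comm]
  refine mul_le_mul_of_nonneg_left (minUpTo_le g ?_) (hw _)
  have := Finset.mem_range.1 hj
  omega

/-! ### Growth of the mixing time -/

theorem tendsto_mixTime {c : Constants} (hc : c.Valid) {a : ℝ} (ha : 0 < a) :
    Tendsto (mixTime c a) atTop atTop := by
  refine tendsto_atTop.2 fun n => ?_
  have hpos : 0 < c.m * c.ρ ^ n := mul_pos hc.m_pos (pow_pos hc.ρ_pos n)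
  filter_upwards [(tendsto_stepα a).eventually (gt_mem_nhds hpos)] with k hk
  by_contra! hlt
  have h1 := (mixTime_spec hc ha k).2
  have h2 := mul_le_mul_of_nonneg_left
    (pow_le_pow_of_le_one hc.ρ_pos.le hc.ρ_lt_one.le hlt.le) hc.m_pos.le
  linarith

/-- The mixing time grows slower than `k ^ (1/10)`, as a geometric sequence decays faster than
`n ^ (-6)`. -/
theorem eventually_mixTime_le {c : Constants} (hc : c.Valid) {a : ℝ} (ha : 0 < a) :
    ∀ᶠ k : ℕ in atTop, (mixTime c a k : ℝ) ≤ 2 * ((k : ℝ) + 1) ^ (1 / 10 : ℝ) := by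
  have hgeo : Tendsto (fun n : ℕ => c.m * ((n : ℝ) ^ 6 * c.ρ ^ n)) atTop (nhds 0) := by
    simpa using (tendsto_pow_const_mul_const_pow_of_abs_lt_one 6
      (by rw [abs_of_pos hc.ρ_pos]; exact hc.ρ_lt_one)).const_mul c.m
  have hy : Tendsto (fun k : ℕ => ((k : ℝ) + 1) ^ (1 / 10 : ℝ)) atTop atTop :=
    (tendsto_rpow_atTop (by norm_num)).comp
      (tendsto_atTop_add_const_right _ _ tendsto_natCast_atTop_atTop)
  have hn := tendsto_nat_ceil_atTop.comp hy
  filter_upwards [hn.eventually (hgeo.eventually (gt_mem_nhds ha)),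
    hy.eventually (eventually_ge_atTop 1)] with k hk hk1
  set y := ((k : ℝ) + 1) ^ (1 / 10 : ℝ) with hydef
  simp only [Function.comp_apply] at hk
  rw [← hydef] at hk
  have hky : y ≤ (⌈y⌉₊ : ℝ) := Nat.le_ceil y
  have hpos : (0 : ℝ) < (k : ℝ) + 1 := by positivity
  have hpow : ((k : ℝ) + 1) ^ (3 / 5 : ℝ) ≤ (⌈y⌉₊ : ℝ) ^ 6 := by
    calc ((k : ℝ) + 1) ^ (3 / 5 : ℝ) = y ^ 6 := by
          rw [hydef, ← Real.rpow_natCast, ← Real.rpow_mul hpos.le]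
          norm_num
      _ ≤ (⌈y⌉₊ : ℝ) ^ 6 := pow_le_pow_left₀ (by linarith) hky 6
  have hle : mixTime c a k ≤ ⌈y⌉₊ := by
    refine mixTime_le (Nat.one_le_ceil_iff.2 (by linarith)) ?_
    unfold stepα
    rw [le_div_iff₀ (Real.rpow_pos_of_pos hpos _)]
    have hm : 0 ≤ c.m * c.ρ ^ ⌈y⌉₊ := mul_nonneg hc.m_pos.le (pow_nonneg hc.ρ_pos.le _)
    linarith [mul_le_mul_of_nonneg_left hpow hm]
  have h1 : (mixTime c a k : ℝ) ≤ (⌈y⌉₊ : ℝ) := by exact_mod_cast hle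
  have h2 := Nat.ceil_lt_add_one (by linarith : 0 ≤ y)
  linarith

/-- With `y = (k + 1) ^ (1/10)` one has `τ_k ≤ 2 y` and `k - τ_k + 1 ≥ y ^ 8` for large `k`, so that
`τ_k ^ 2 * β_{k - τ_k}` is of order `y ^ 2 / y ^ 3` at most. -/
theorem eventually_stepβ_le {c : Constants} (hc : c.Valid) {a b : ℝ} (ha : 0 < a) (hb : 0 < b)
    {ε : ℝ} (hε : 0 < ε) :
    ∀ᶠ k : ℕ in atTop, 2 * mixTime c a k ≤ k ∧
      (mixTime c a k : ℝ) ^ 2 * stepβ b (k - mixTime c a k) ≤ ε := by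
  have hy : Tendsto (fun k : ℕ => ((k : ℝ) + 1) ^ (1 / 10 : ℝ)) atTop atTop :=
    (tendsto_rpow_atTop (by norm_num)).comp
      (tendsto_atTop_add_const_right _ _ tendsto_natCast_atTop_atTop)
  filter_upwards [eventually_mixTime_le hc ha, hy.eventually (eventually_ge_atTop 2),
    hy.eventually (eventually_ge_atTop (4 * b / ε))] with k hτ hy2 hyε
  have hpos : (0 : ℝ) < (k : ℝ) + 1 := by positivity
  set y := ((k : ℝ) + 1) ^ (1 / 10 : ℝ) with hydef
  have hy0 : 0 < y := by linarith
  have hk : (k : ℝ) + 1 = y ^ 10 := by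
    rw [hydef, ← Real.rpow_natCast, ← Real.rpow_mul hpos.le]
    norm_num
  have hpow : ∀ n : ℕ, (2 : ℝ) ^ n ≤ y ^ n := fun n => pow_le_pow_left₀ (by norm_num) hy2 n
  have h2τ : 2 * mixTime c a k ≤ k := by
    have : (2 : ℝ) * mixTime c a k ≤ k := by
      have h9 := mul_le_mul_of_nonneg_left (hpow 9) hy0.le
      norm_num at h9
      nlinarith
    exact_mod_cast this
  refine ⟨h2τ, ?_⟩
  have hsub : y ^ 8 ≤ (((k - mixTime c a k : ℕ)) : ℝ) + 1 := by
    rw [Nat.cast_sub (by omega)]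
    have h8 := mul_le_mul_of_nonneg_left (hpow 2) (pow_nonneg hy0.le 8)
    have h7 := mul_le_mul_of_nonneg_left (hpow 7) hy0.le
    norm_num at h7 h8
    nlinarith
  have hβ : y ^ 3 ≤ ((((k - mixTime c a k : ℕ)) : ℝ) + 1) ^ (2 / 5 : ℝ) := by
    calc y ^ 3 ≤ (y ^ 8) ^ (2 / 5 : ℝ) := by
          rw [← Real.rpow_natCast, ← Real.rpow_natCast, ← Real.rpow_mul hy0.le]
          exact Real.rpow_le_rpow_of_exponent_le (by linarith) (by norm_num)
      _ ≤ _ := Real.rpow_le_rpow (by positivity) hsub (by norm_num)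
  have hy3 : 0 < y ^ 3 := by positivity
  have h1 : stepβ b (k - mixTime c a k) ≤ b / y ^ 3 := by
    unfold stepβ
    gcongr
  calc (mixTime c a k : ℝ) ^ 2 * stepβ b (k - mixTime c a k)
      ≤ (2 * y) ^ 2 * (b / y ^ 3) := by
        have := (stepβ_pos hb (k - mixTime c a k)).le
        gcongr
    _ = 4 * b / y := by field_simp; norm_num
    _ ≤ ε := by
        rw [div_le_iff₀ hy0]
        rwa [div_le_iff₀' hε] at hyε

/-- For large `k` the mixing time is at most `k / 2` and the step-size condition with a given
threshold holds on the whole interval `[τ_k, k]`, since `τ_k → ∞`. -/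
theorem eventually_forall_stepβ_le {c : Constants} (hc : c.Valid) {a b : ℝ} (ha : 0 < a)
    (hb : 0 < b) {ε : ℝ} (hε : 0 < ε) :
    ∀ᶠ k : ℕ in atTop, 2 * mixTime c a k ≤ k ∧ ∀ t, mixTime c a k ≤ t → t ≤ k →
      (mixTime c a t : ℝ) ^ 2 * stepβ b (t - mixTime c a t) ≤ ε ∧
      stepβ b (t - mixTime c a t) ≤ 1 := by
  obtain ⟨K, hK⟩ := eventually_atTop.1 (eventually_stepβ_le hc ha hb (lt_min hε one_pos))
  filter_upwards [eventually_ge_atTop K, (tendsto_mixTime hc ha).eventually (eventually_ge_atTop K)]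
    with k hk hτ
  refine ⟨(hK k hk).1, fun t ht _ => ?_⟩
  have h1 := (hK t (hτ.trans ht)).2
  have hone : (1 : ℝ) ≤ (mixTime c a t : ℝ) ^ 2 :=
    one_le_pow₀ (by exact_mod_cast (mixTime_spec hc ha t).1)
  refine ⟨h1.trans (min_le_left _ _), ?_⟩
  exact (le_mul_of_one_le_left (stepβ_pos hb _).le hone).trans (h1.trans (min_le_right _ _))

/-! ### Constants -/


theorem Cν_pos : 0 < Cν := by
  have : (1 : ℝ) < 2 ^ (2 / 5 : ℝ) := Real.one_lt_rpow (by norm_num) (by norm_num)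
  unfold Cν
  rw [sub_pos, div_lt_one (by positivity)]
  exact this

theorem Cν_le : Cν ≤ 2 / 5 := by
  have h : (2 : ℝ) ^ (2 / 5 : ℝ) ≤ 5 / 3 := by
    have h5 : ((2 : ℝ) ^ (2 / 5 : ℝ)) ^ 5 ≤ (5 / 3 : ℝ) ^ 5 := by
      rw [← Real.rpow_natCast, ← Real.rpow_mul (by norm_num)]
      norm_num
    exact le_of_pow_le_pow_left₀ (by norm_num) (by norm_num) h5
  unfold Cν
  have h2 : 3 / 5 ≤ 1 / (2 : ℝ) ^ (2 / 5 : ℝ) := by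
    rw [le_div_iff₀ (by positivity)]
    linarith
  linarith

theorem C₁_nonneg {c : Constants} (hc : c.Valid) : 0 ≤ C₁ c := by
  have := hc.B_pos; have := hc.LF_nonneg; have := hc.Lω_nonneg; have := hc.Lf_nonneg
  have := hc.LTV_nonneg; have := hc.Lμ_nonneg
  unfold C₁
  positivity

theorem C₂_nonneg {c : Constants} (hc : c.Valid) {a b : ℝ} (ha : 0 < a) (hb : 0 < b) :
    0 ≤ C₂ c a b := by
  have := hc.B_pos; have := hc.LG_nonneg; have := hc.LTV_nonneg; have := hc.Lμ_nonneg
  unfold C₂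
  positivity

theorem C₃_nonneg {c : Constants} (hc : c.Valid) {a b : ℝ} (ha : 0 < a) (hb : 0 < b) :
    0 ≤ C₃ c a b := by
  have := hc.B_pos; have := hc.Lω_nonneg; have := hc.lamG_pos; have := C₂_nonneg hc ha hb
  unfold C₃
  positivity

/-! ### Total variation -/

theorem abs_integral_sub_le_tvDist {S : Type*} [MeasurableSpace S] {μ ν : Measure S}
    [IsProbabilityMeasure μ] [IsProbabilityMeasure ν] {g : S → ℝ} (hg : Measurable g) {M : ℝ}
    (hM : ∀ x, |g x| ≤ M) : |∫ x, g x ∂μ - ∫ x, g x ∂ν| ≤ 2 * M * tvDist μ ν := by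
  have hbd : BddAbove {a : ℝ | ∃ g : S → ℝ, Measurable g ∧ (∀ x, |g x| ≤ 1) ∧
      a = |∫ x, g x ∂μ - ∫ x, g x ∂ν|} := by
    refine ⟨2, ?_⟩
    rintro a ⟨g, -, hg1, rfl⟩
    have h1 := norm_integral_le_of_norm_le_const (μ := μ) (f := g) (C := 1) (ae_of_all _ hg1)
    have h2 := norm_integral_le_of_norm_le_const (μ := ν) (f := g) (C := 1) (ae_of_all _ hg1)
    simp only [Real.norm_eq_abs, probReal_univ, mul_one] at h1 h2
    exact (abs_sub _ _).trans (by linarith)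
  obtain ⟨x₀⟩ : Nonempty S := nonempty_of_isProbabilityMeasure μ
  rcases (le_trans (abs_nonneg _) (hM x₀)).eq_or_lt with h0 | h0
  · have hz : g = fun _ => 0 := by
      funext x
      have := hM x
      rw [← h0] at this
      exact abs_nonpos_iff.1 this
    simp [hz, ← h0]
  · have hmem := le_csSup hbd ⟨fun x => M⁻¹ * g x, hg.const_mul _, fun x => by
      rw [abs_mul, abs_of_pos (inv_pos.2 h0), inv_mul_le_iff₀ h0]
      simpa using hM x, rfl⟩
    rw [integral_const_mul, integral_const_mul, ← mul_sub, abs_mul, abs_of_pos (inv_pos.2 h0),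
      inv_mul_le_iff₀ h0] at hmem
    unfold tvDist
    linarith

theorem abs_measureReal_sub_le_tvDist {S : Type*} [MeasurableSpace S] {μ ν : Measure S}
    [IsProbabilityMeasure μ] [IsProbabilityMeasure ν] {A : Set S} (hA : MeasurableSet A) :
    |μ.real A - ν.real A| ≤ 2 * tvDist μ ν := by
  have h := abs_integral_sub_le_tvDist (μ := μ) (ν := ν)
    ((measurable_const (a := (1 : ℝ))).indicator hA) (M := 1) (fun x => by
      by_cases hx : x ∈ A <;> simp [hx])
  simpa [integral_indicator hA] using h

theorem continuous_of_abs_sub_le {d : ℕ} {u : E d → ℝ} {K : ℝ}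
    (h : ∀ θ θ', |u θ - u θ'| ≤ K * ‖θ - θ'‖) : Continuous u := by
  have : LipschitzWith K.toNNReal u := LipschitzWith.of_dist_le_mul fun x y => by
    rw [Real.dist_eq, dist_eq_norm]
    exact (h x y).trans (mul_le_mul_of_nonneg_right (Real.le_coe_toNNReal K) (norm_nonneg _))
  exact this.continuous

/-! ### Parametrized kernels -/

section ParamKernel

variable {S : Type*} [MeasurableSpace S] {d : ℕ}

/-- A family of Markov kernels that is Lipschitz in its parameter for the total variation distance,
as one kernel from pairs (parameter, state): its masses are continuous in the parameter and
measurable in the state, hence jointly measurable. -/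
noncomputable def paramKernel (P : E d → Kernel S S) (hP : ∀ θ, IsMarkovKernel (P θ)) {K : ℝ}
    (hL : ∀ θ θ' x, tvDist (P θ x) (P θ' x) ≤ K * ‖θ - θ'‖) : Kernel (E d × S) S where
  toFun p := P p.1 p.2
  measurable' := by
    refine Measure.measurable_of_measurable_coe _ fun A hA => ?_
    have hj : Measurable (Function.uncurry fun (θ : E d) (x : S) => (P θ x).real A) := by
      refine measurable_uncurry_of_continuous_of_measurable (fun x => ?_) (fun θ => ?_)
      · refine continuous_of_abs_sub_le (K := 2 * K) fun θ θ' => ?_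
        have h1 := abs_measureReal_sub_le_tvDist (μ := P θ x) (ν := P θ' x) hA
        have h2 := hL θ θ' x
        linarith
      · exact ((P θ).measurable_coe hA).ennreal_toReal
    have he : (fun p : E d × S => P p.1 p.2 A)
        = fun p => ENNReal.ofReal (Function.uncurry (fun θ x => (P θ x).real A) p) := by
      funext p
      simp [Function.uncurry, ofReal_measureReal]
    rw [he]
    exact hj.ennreal_ofReal

theorem paramKernel_apply (P : E d → Kernel S S) (hP : ∀ θ, IsMarkovKernel (P θ)) {K : ℝ}
    (hL : ∀ θ θ' x, tvDist (P θ x) (P θ' x) ≤ K * ‖θ - θ'‖) (p : E d × S) :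
    paramKernel P hP hL p = P p.1 p.2 := rfl

instance isMarkovKernel_paramKernel (P : E d → Kernel S S) (hP : ∀ θ, IsMarkovKernel (P θ))
    {K : ℝ} (hL : ∀ θ θ' x, tvDist (P θ x) (P θ' x) ≤ K * ‖θ - θ'‖) :
    IsMarkovKernel (paramKernel P hP hL) :=
  ⟨fun p => by rw [paramKernel_apply]; infer_instance⟩

/-- A Lipschitz family of probability measures as a kernel. -/
noncomputable def paramMeasure (π : E d → Measure S) (hπ : ∀ θ, IsProbabilityMeasure (π θ)) {K : ℝ}
    (hL : ∀ θ θ', tvDist (π θ) (π θ') ≤ K * ‖θ - θ'‖) : Kernel (E d) S where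
  toFun := π
  measurable' := by
    refine Measure.measurable_of_measurable_coe _ fun A hA => ?_
    have hj : Measurable fun θ => (π θ).real A := by
      refine (continuous_of_abs_sub_le (K := 2 * K) fun θ θ' => ?_).measurable
      have h1 := abs_measureReal_sub_le_tvDist (μ := π θ) (ν := π θ') hA
      have h2 := hL θ θ'
      linarith
    have he : (fun θ => π θ A) = fun θ => ENNReal.ofReal ((π θ).real A) := by
      funext θ
      simp [ofReal_measureReal]
    rw [he]
    exact hj.ennreal_ofReal

theorem paramMeasure_apply (π : E d → Measure S) (hπ : ∀ θ, IsProbabilityMeasure (π θ)) {K : ℝ}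
    (hL : ∀ θ θ', tvDist (π θ) (π θ') ≤ K * ‖θ - θ'‖) (θ : E d) :
    paramMeasure π hπ hL θ = π θ := rfl

instance isMarkovKernel_paramMeasure (π : E d → Measure S) (hπ : ∀ θ, IsProbabilityMeasure (π θ))
    {K : ℝ} (hL : ∀ θ θ', tvDist (π θ) (π θ') ≤ K * ‖θ - θ'‖) :
    IsMarkovKernel (paramMeasure π hπ hL) :=
  ⟨fun p => by rw [paramMeasure_apply]; infer_instance⟩

/-! ### Conditional laws -/

/-- If `κ (V ·)` gives the conditional probabilities of `Y` given `m` and `V` is `m`-measurable, then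
`(V, Y)` has law `κ` integrated against the law of `V`. -/
theorem map_prodMk_eq_compProd {Ω W : Type*} {m mΩ : MeasurableSpace Ω} [MeasurableSpace W]
    {Pr : Measure Ω} [IsProbabilityMeasure Pr] (hm : m ≤ mΩ)
    {V : Ω → W} (hV : Measurable[m] V) {Y : Ω → S} (hY : Measurable Y)
    (κ : Kernel W S) [IsMarkovKernel κ]
    (h : ∀ A, MeasurableSet A → Pr[(Y ⁻¹' A).indicator (fun _ => (1 : ℝ)) | m]
      =ᵐ[Pr] fun o => (κ (V o)).real A) :
    Pr.map (fun o => (V o, Y o)) = (Pr.map V) ⊗ₘ κ := by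
  have hV' : Measurable V := hV.mono hm le_rfl
  have : IsProbabilityMeasure (Pr.map V) := Measure.isProbabilityMeasure_map hV'.aemeasurable
  have : IsProbabilityMeasure (Pr.map fun o => (V o, Y o)) :=
    Measure.isProbabilityMeasure_map (hV'.prodMk hY).aemeasurable
  refine Measure.ext_prod fun {B A} hB hA => ?_
  rw [Measure.map_apply (hV'.prodMk hY) (hB.prod hA), Measure.compProd_apply_prod hB hA,
    setLIntegral_map hB (κ.measurable_coe hA) hV']
  have hset : (fun o => (V o, Y o)) ⁻¹' B ×ˢ A = V ⁻¹' B ∩ Y ⁻¹' A := rfl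
  have hint : Integrable ((Y ⁻¹' A).indicator fun _ => (1 : ℝ)) Pr :=
    (integrable_const 1).indicator (hY hA)
  have e1 := setIntegral_condExp hm hint (hV hB)
  rw [setIntegral_congr_ae (g := fun o => (κ (V o)).real A) (hm _ (hV hB))
    ((h A hA).mono fun o ho _ => ho), setIntegral_indicator (hY hA)] at e1
  simp only [integral_const, smul_eq_mul, mul_one, measureReal_restrict_apply_univ] at e1
  have e2 : ∫⁻ o in V ⁻¹' B, κ (V o) A ∂Pr
      = ENNReal.ofReal (∫ o in V ⁻¹' B, (κ (V o)).real A ∂Pr) := by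
    have hmeas : Measurable fun o => (κ (V o)).real A :=
      ((κ.measurable_coe hA).comp hV').ennreal_toReal
    rw [ofReal_integral_eq_lintegral_ofReal]
    · simp [ofReal_measureReal]
    · exact Integrable.of_bound hmeas.aestronglyMeasurable 1 (ae_of_all _ fun o => by
        rw [Real.norm_of_nonneg measureReal_nonneg]; exact measureReal_le_one)
    · exact ae_of_all _ fun o => measureReal_nonneg
  rw [hset, e2, e1, ofReal_measureReal]

/-- Conditioning inside an expectation: integrate out `Y` given `V`. -/
theorem integral_comp_eq_integral_kernel {Ω W : Type*} {m mΩ : MeasurableSpace Ω}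
    [MeasurableSpace W] {Pr : Measure Ω} [IsProbabilityMeasure Pr]
    (hm : m ≤ mΩ) {V : Ω → W} (hV : Measurable[m] V) {Y : Ω → S} (hY : Measurable Y)
    (κ : Kernel W S) [IsMarkovKernel κ]
    (h : ∀ A, MeasurableSet A → Pr[(Y ⁻¹' A).indicator (fun _ => (1 : ℝ)) | m]
      =ᵐ[Pr] fun o => (κ (V o)).real A)
    {Φ : W × S → ℝ} (hΦ : Measurable Φ) (hint : Integrable (fun o => Φ (V o, Y o)) Pr) :
    ∫ o, Φ (V o, Y o) ∂Pr = ∫ o, ∫ y, Φ (V o, y) ∂(κ (V o)) ∂Pr := by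
  have hV' : Measurable V := hV.mono hm le_rfl
  have : IsProbabilityMeasure (Pr.map V) := Measure.isProbabilityMeasure_map hV'.aemeasurable
  have hlaw := map_prodMk_eq_compProd hm hV hY κ h
  have hi : Integrable Φ ((Pr.map V) ⊗ₘ κ) := by
    rw [← hlaw, integrable_map_measure hΦ.aestronglyMeasurable (hV'.prodMk hY).aemeasurable]
    exact hint
  have e := integral_map (μ := Pr) (hV'.prodMk hY).aemeasurable (f := Φ)
    hΦ.aestronglyMeasurable
  rw [← e, hlaw, Measure.integral_compProd hi, integral_map hV'.aemeasurable]
  exact (hΦ.stronglyMeasurable.integral_kernel_prod_right (f := fun a b => Φ (a, b))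
    ).aestronglyMeasurable

end ParamKernel

/-! ### Comparison with the chain of a frozen parameter -/

section Frozen

variable {S Q : Type*} [MeasurableSpace S] [MeasurableSpace Q] {d : ℕ}

/-- `frozen P ϑ H j q x` is the expectation of `H q` after `j` steps of the chain with the constant
parameter `ϑ q`, started at `x`. -/
noncomputable def frozen (P : E d → Kernel S S) (ϑ : Q → E d) (H : Q → S → ℝ) : ℕ → Q → S → ℝ
  | 0 => H
  | j + 1 => fun q x => ∫ y, frozen P ϑ H j q y ∂(P (ϑ q) x)

theorem measurable_frozen {P : E d → Kernel S S} (hP : ∀ θ, IsMarkovKernel (P θ)) {K : ℝ}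
    (hL : ∀ θ θ' x, tvDist (P θ x) (P θ' x) ≤ K * ‖θ - θ'‖) {ϑ : Q → E d} (hϑ : Measurable ϑ)
    {H : Q → S → ℝ} (hH : Measurable (Function.uncurry H)) (j : ℕ) :
    Measurable (Function.uncurry (frozen P ϑ H j)) := by
  induction j with
  | zero => exact hH
  | succ j ih =>
    have hg : Measurable fun p : Q × S => (ϑ p.1, p.2) :=
      (hϑ.comp measurable_fst).prodMk measurable_snd
    have hm : Measurable (Function.uncurry fun (p : Q × S) (y : S) => frozen P ϑ H j p.1 y) :=
      ih.comp ((measurable_fst.comp measurable_fst).prodMk measurable_snd)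
    have := hm.stronglyMeasurable.integral_kernel_prod_right
      (κ := (paramKernel P hP hL).comap _ hg)
    exact this.measurable

theorem abs_frozen_le {Q : Type*} {P : E d → Kernel S S} (hP : ∀ θ, IsMarkovKernel (P θ)) {ϑ : Q → E d}
    {H : Q → S → ℝ} {q : Q} {M : ℝ} (hM : ∀ x, |H q x| ≤ M) (j : ℕ) (x : S) :
    |frozen P ϑ H j q x| ≤ M := by
  induction j generalizing x with
  | zero => exact hM x
  | succ j ih =>
    have := norm_integral_le_of_norm_le_const (μ := P (ϑ q) x) (f := frozen P ϑ H j q) (C := M)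
      (ae_of_all _ ih)
    simpa [frozen] using this

theorem isMarkovKernel_pow (κ : Kernel S S) [IsMarkovKernel κ] (j : ℕ) : IsMarkovKernel (κ ^ j) := by
  induction j with
  | zero => rw [pow_zero]; exact inferInstanceAs (IsMarkovKernel Kernel.id)
  | succ j ih => rw [pow_succ]; exact inferInstanceAs (IsMarkovKernel ((κ ^ j) ∘ₖ κ))

theorem frozen_eq_integral_pow {P : E d → Kernel S S} (hP : ∀ θ, IsMarkovKernel (P θ)) {ϑ : Q → E d}
    {H : Q → S → ℝ} (hH : Measurable (Function.uncurry H)) {q : Q} {M : ℝ}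
    (hM : ∀ x, |H q x| ≤ M) (j : ℕ) (x : S) :
    frozen P ϑ H j q x = ∫ y, H q y ∂((P (ϑ q) ^ j) x) := by
  have hHq : Measurable (H q) := hH.comp measurable_prodMk_left
  have hmk := isMarkovKernel_pow (P (ϑ q))
  induction j generalizing x with
  | zero =>
    rw [pow_zero]
    change H q x = ∫ y, H q y ∂(Kernel.id x)
    rw [Kernel.id_apply, integral_dirac' _ _ hHq.stronglyMeasurable]
  | succ j ih =>
    have hi : Integrable (H q) (((P (ϑ q) ^ j) ∘ₖ P (ϑ q)) x) :=
      Integrable.of_bound hHq.aestronglyMeasurable M (ae_of_all _ hM)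
    rw [pow_succ]
    change _ = ∫ y, H q y ∂(((P (ϑ q) ^ j) ∘ₖ P (ϑ q)) x)
    rw [Kernel.integral_comp hi]
    exact integral_congr_ae (ae_of_all _ ih)

/-- Mixing along a controlled chain: if the parameter moves by at most `K` per step, then the
expectation of `H p` at the state `τ` steps after time `s` is close to its stationary expectation
for the parameter at time `s`, where `p` is known at time `s`.

The state is compared with the chain of the frozen parameter `θ_s`, one transition at a time: the
transition `i + 1` steps after time `s` costs `2 * LTV * (K * (i + 1))`. -/
theorem abs_integral_sub_stationary_le {Ω : Type*} {mΩ : MeasurableSpace Ω}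
    {P : E d → Kernel S S} (hP : ∀ θ, IsMarkovKernel (P θ)) {LTV : ℝ} (hLTV : 0 ≤ LTV)
    (hL : ∀ θ θ' x, tvDist (P θ x) (P θ' x) ≤ LTV * ‖θ - θ'‖)
    {π : E d → Measure S} (hπ : ∀ θ, IsProbabilityMeasure (π θ))
    {Lμ : ℝ} (hLπ : ∀ θ θ', tvDist (π θ) (π θ') ≤ Lμ * ‖θ - θ'‖)
    {Pr : Measure Ω} [IsProbabilityMeasure Pr] {ℱ : Filtration ℕ mΩ} {X : ℕ → Ω → S}
    {θ : ℕ → Ω → E d} (hX : IsControlledChain P Pr ℱ X θ)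
    (hθ : ∀ k, Measurable[ℱ k] (θ (k + 1))) {s τ : ℕ} {p : Ω → Q} (hp : Measurable[ℱ s] p)
    {ϑ : Q → E d} (hϑ : Measurable ϑ) (hpθ : ∀ o, ϑ (p o) = θ s o)
    {K : ℝ} (hK : ∀ i o, ‖θ (s + i) o - θ s o‖ ≤ K * i)
    {ε : ℝ} (hmix : ∀ θ x, tvDist ((P θ ^ τ) x) (π θ) ≤ ε)
    {H : Q → S → ℝ} (hH : Measurable (Function.uncurry H)) {M : Ω → ℝ} (hMi : Integrable M Pr)
    (hM : ∀ᵐ o ∂Pr, ∀ x, |H (p o) x| ≤ M o) :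
    |∫ o, H (p o) (X (s + τ) o) ∂Pr - ∫ o, ∫ y, H (p o) y ∂(π (θ s o)) ∂Pr|
      ≤ (LTV * K * (τ * (τ + 1)) + 2 * ε) * ∫ o, M o ∂Pr := by
  have hXm : ∀ k, Measurable (X k) := fun k => (hX.adapted k).mono (ℱ.le k) le_rfl
  have hpm : Measurable p := hp.mono (ℱ.le s) le_rfl
  have hθm : ∀ k, Measurable (θ (k + 1)) := fun k => (hθ k).mono (ℱ.le k) le_rfl
  have hfm := measurable_frozen hP hL hϑ hH
  have hfi : ∀ j k, Integrable (fun o => frozen P ϑ H j (p o) (X k o)) Pr := fun j k =>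
    hMi.mono' ((hfm j).comp (hpm.prodMk (hXm k))).aestronglyMeasurable
      (hM.mono fun o ho => abs_frozen_le hP ho j _)
  -- one transition
  have hstep : ∀ j i, |∫ o, frozen P ϑ H j (p o) (X (s + i + 1) o) ∂Pr
      - ∫ o, frozen P ϑ H (j + 1) (p o) (X (s + i) o) ∂Pr|
      ≤ 2 * LTV * (K * (i + 1)) * ∫ o, M o ∂Pr := by
    intro j i
    have hV : Measurable[ℱ (s + i)] fun o => (p o, (θ (s + i + 1) o, X (s + i) o)) :=
      (hp.mono (ℱ.mono (Nat.le_add_right s i)) le_rfl).prodMk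
        ((hθ (s + i)).prodMk (hX.adapted (s + i)))
    have hΦ : Measurable fun v : (Q × (E d × S)) × S => frozen P ϑ H j v.1.1 v.2 :=
      (hfm j).comp ((measurable_fst.comp measurable_fst).prodMk measurable_snd)
    have e := integral_comp_eq_integral_kernel (ℱ.le (s + i)) hV (hXm (s + i + 1))
      ((paramKernel P hP hL).comap _ measurable_snd)
      (fun A hA => hX.transition (s + i) A hA) hΦ (hfi j (s + i + 1))
    simp only [Kernel.comap_apply, paramKernel_apply] at e
    have hi1 : Integrable (fun o => ∫ y, frozen P ϑ H j (p o) y ∂(P (θ (s + i + 1) o) (X (s + i) o)))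
        Pr := by
      refine hMi.mono' ?_ (hM.mono fun o ho => ?_)
      · have hm := (hΦ.stronglyMeasurable.integral_kernel_prod_right
          (κ := (paramKernel P hP hL).comap _ measurable_snd)
          (f := fun a b => frozen P ϑ H j a.1 b)).measurable
        exact (hm.comp (hV.mono (ℱ.le (s + i)) le_rfl)).aestronglyMeasurable
      · have := norm_integral_le_of_norm_le_const (μ := P (θ (s + i + 1) o) (X (s + i) o))
          (f := frozen P ϑ H j (p o)) (C := M o) (ae_of_all _ (abs_frozen_le hP ho j))
        simpa using this
    rw [e, ← integral_sub hi1 (hfi (j + 1) (s + i)), ← integral_const_mul, ← Real.norm_eq_abs]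
    refine norm_integral_le_of_norm_le (hMi.const_mul _) (hM.mono fun o ho => ?_)
    obtain ⟨x⟩ : Nonempty S := ⟨X 0 o⟩
    have hM0 : 0 ≤ M o := (abs_nonneg _).trans (ho x)
    have h1 := abs_integral_sub_le_tvDist (μ := P (θ (s + i + 1) o) (X (s + i) o))
      (ν := P (θ s o) (X (s + i) o)) (g := frozen P ϑ H j (p o))
      ((hfm j).comp measurable_prodMk_left) (abs_frozen_le hP ho j)
    have h2 := hL (θ (s + i + 1) o) (θ s o) (X (s + i) o)
    have h3 := hK (i + 1) o
    push_cast at h3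
    change |_ - ∫ y, frozen P ϑ H j (p o) y ∂(P (ϑ (p o)) (X (s + i) o))| ≤ _
    rw [hpθ]
    refine h1.trans ?_
    have h4 := h2.trans (mul_le_mul_of_nonneg_left h3 hLTV)
    nlinarith [mul_le_mul_of_nonneg_left h4 hM0]
  -- all transitions
  have hall : ∀ n j, |∫ o, frozen P ϑ H j (p o) (X (s + n) o) ∂Pr
      - ∫ o, frozen P ϑ H (j + n) (p o) (X s o) ∂Pr|
      ≤ LTV * K * (n * (n + 1)) * ∫ o, M o ∂Pr := by
    intro n
    induction n with
    | zero => intro j; simp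
    | succ n ih =>
      intro j
      have h1 := hstep j n
      have h2 := ih (j + 1)
      rw [show j + 1 + n = j + (n + 1) by ring] at h2
      refine (abs_sub_le _ _ _).trans ((add_le_add h1 h2).trans (le_of_eq ?_))
      push_cast
      ring
  have h1 := hall τ 0
  rw [zero_add] at h1
  have hπi : Integrable (fun o => ∫ y, H (p o) y ∂(π (θ s o))) Pr := by
    refine hMi.mono' ?_ (hM.mono fun o ho => ?_)
    · have hm := (hH.stronglyMeasurable.integral_kernel_prod_right
        (κ := (paramMeasure π hπ hLπ).comap _ hϑ)).measurable
      have hm2 := (hm.comp hpm).aestronglyMeasurable (μ := Pr)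
      refine hm2.congr (ae_of_all _ fun o => ?_)
      simp [Kernel.comap_apply, paramMeasure_apply, hpθ]
    · have := norm_integral_le_of_norm_le_const (μ := π (θ s o))
        (f := H (p o)) (C := M o) (ae_of_all _ ho)
      simpa using this
  have h2 : |∫ o, frozen P ϑ H τ (p o) (X s o) ∂Pr - ∫ o, ∫ y, H (p o) y ∂(π (θ s o)) ∂Pr|
      ≤ 2 * ε * ∫ o, M o ∂Pr := by
    rw [← integral_sub (hfi τ s) hπi, ← integral_const_mul, ← Real.norm_eq_abs]
    refine norm_integral_le_of_norm_le (hMi.const_mul _) (hM.mono fun o ho => ?_)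
    have hM0 : 0 ≤ M o := (abs_nonneg _).trans (ho (X 0 o))
    have hmk := isMarkovKernel_pow (P (θ s o)) τ
    rw [frozen_eq_integral_pow hP hH ho, hpθ]
    have h3 := abs_integral_sub_le_tvDist (μ := (P (θ s o) ^ τ) (X s o)) (ν := π (θ s o))
      (g := H (p o)) (hH.comp measurable_prodMk_left) ho
    have h4 := hmix (θ s o) (X s o)
    refine h3.trans ?_
    nlinarith [mul_le_mul_of_nonneg_left h4 hM0]
  rw [add_mul]
  exact (abs_sub_le _ _ _).trans (add_le_add h1 h2)

end Frozen

/-! ### Linear drift inequalities -/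

theorem integral_le_of_ae_le_linear {Ω : Type*} [MeasurableSpace Ω] {Pr : Measure Ω}
    [IsProbabilityMeasure Pr] {y a b g : Ω → ℝ} (hy : Integrable y Pr) (ha : Integrable a Pr)
    (hb : Integrable b Pr) (hg : Integrable g Pr) {p q w k : ℝ}
    (h : ∀ᵐ o ∂Pr, y o ≤ p * a o + q * b o + w * g o + k) :
    ∫ o, y o ∂Pr ≤ p * ∫ o, a o ∂Pr + q * ∫ o, b o ∂Pr + w * ∫ o, g o ∂Pr + k := by
  have h1 : Integrable (fun o => p * a o + q * b o) Pr := (ha.const_mul p).add (hb.const_mul q)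
  have h2 : Integrable (fun o => p * a o + q * b o + w * g o) Pr := h1.add (hg.const_mul w)
  refine (integral_mono_ae hy (h2.add (integrable_const k)) h).trans_eq ?_
  rw [integral_add' h2 (integrable_const k), integral_add h1 (hg.const_mul w),
    integral_add (ha.const_mul p) (hb.const_mul q), integral_const_mul, integral_const_mul,
    integral_const_mul, integral_const, probReal_univ, one_smul]

/-- Absorption of the linear terms in the drift inequality: Young's inequality is applied to the
motion of the target and to the Markovian noise, each using half of the contraction `lam * β`. -/
theorem drift_of_noise_le {B A D Lω LG lam T α β b V V' N Z Zs : ℝ} (hB : 0 ≤ B) (hA0 : 0 ≤ A)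
    (hD0 : 0 ≤ D) (hlam : 0 < lam) (hT : 1 ≤ T) (hβs : 0 < b)
    (hβ : 0 < β) (hβle : β ≤ b) (hs1 : b ≤ 1) (hs : D * T ^ 2 * b ≤ lam)
    (hint : V' ≤ (1 - 2 * lam * β) * V + 2 * (B * α * (Lω + LG * β)) * Z + 2 * β * N
      + (2 * B ^ 2 * β ^ 2 + 2 * B ^ 2 * Lω ^ 2 * α ^ 2))
    (hN : N ≤ 2 * B * A * T * b + D * T ^ 2 * b * Zs) (hZs : Zs ≤ Z + A * b * T)
    (hJ : Z ^ 2 ≤ V) :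
    lam * β * V ≤ V - V' + 4 * (D / 2 + A * lam + 2 * B * A + 2 * B ^ 2) * T ^ 2 * (β * b)
      + 4 * (LG ^ 2 + Lω ^ 2 * (1 + lam)) * B ^ 2 * α ^ 2 / (lam * β) := by
  have hβ1 : β ≤ 1 := hβle.trans hs1
  set q := D * T ^ 2 * b with hq
  have hq0 : 0 ≤ q := by positivity
  -- Young's inequality for the motion of the target
  have y1 : 2 * (B * α * (Lω + LG * β)) * Z
      ≤ lam * β / 2 * Z ^ 2 + 4 * (LG ^ 2 + Lω ^ 2) * B ^ 2 * α ^ 2 / (lam * β) := by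
    have hlb : 0 < lam * β := by positivity
    have k1 : (Lω + LG * β) ^ 2 ≤ 2 * (LG ^ 2 + Lω ^ 2) := by
      have : (LG * β) ^ 2 ≤ LG ^ 2 := by
        rw [mul_pow]
        exact mul_le_of_le_one_right (sq_nonneg _) (pow_le_one₀ hβ.le hβ1)
      linarith [sq_nonneg (Lω - LG * β)]
    have k2 : 2 * (B * α * (Lω + LG * β)) ^ 2 ≤ 4 * (LG ^ 2 + Lω ^ 2) * B ^ 2 * α ^ 2 := by
      linarith [mul_le_mul_of_nonneg_left k1 (sq_nonneg (B * α))]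
    rw [← sub_le_iff_le_add', le_div_iff₀ hlb]
    linarith [sq_nonneg (lam * β * Z - 2 * (B * α * (Lω + LG * β)))]
  -- Young's inequality for the noise
  have y2 : 2 * β * (q * Z) ≤ lam * β / 2 * Z ^ 2 + 2 * β * q := by
    have k1 : 2 * (q * Z) ≤ lam / 2 * Z ^ 2 + 2 * q := by
      linarith [mul_nonneg hq0 (sq_nonneg (Z - 2)), mul_nonneg (sub_nonneg.2 hs) (sq_nonneg Z)]
    linarith [mul_le_mul_of_nonneg_left k1 hβ.le]
  have hT2 : T ≤ T ^ 2 := le_self_pow₀ hT two_ne_zero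
  have n1 : N ≤ 2 * B * A * T ^ 2 * b + q * Z + lam * A * b * T ^ 2 := by
    have m1 := mul_le_mul_of_nonneg_left hZs hq0
    have m2 : q * (A * b * T) ≤ lam * (A * b * T ^ 2) := by gcongr
    have m3 : 2 * B * A * T * b ≤ 2 * B * A * T ^ 2 * b := by gcongr
    linarith
  have n2 := mul_le_mul_of_nonneg_left n1 (by positivity : 0 ≤ 2 * β)
  have n3 : lam * β * Z ^ 2 ≤ lam * β * V := mul_le_mul_of_nonneg_left hJ (by positivity)
  have n4 : 2 * B ^ 2 * β ^ 2 ≤ 2 * B ^ 2 * (T ^ 2 * (β * b)) := by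
    have : β ^ 2 ≤ T ^ 2 * (β * b) := by
      have h1 : β * β ≤ β * b := mul_le_mul_of_nonneg_left hβle hβ.le
      have h2 : β * b ≤ T ^ 2 * (β * b) := le_mul_of_one_le_left (by positivity) (one_le_pow₀ hT)
      linarith
    exact mul_le_mul_of_nonneg_left this (by positivity)
  have n5 : 2 * B ^ 2 * Lω ^ 2 * α ^ 2 ≤ 4 * (Lω ^ 2 * lam) * B ^ 2 * α ^ 2 / (lam * β) := by
    rw [le_div_iff₀ (by positivity)]
    have hW : 0 ≤ B ^ 2 * Lω ^ 2 * α ^ 2 * lam := by positivity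
    linarith [mul_le_of_le_one_right hW hβ1]
  have n6 : 4 * (LG ^ 2 + Lω ^ 2 * (1 + lam)) * B ^ 2 * α ^ 2 / (lam * β)
      = 4 * (LG ^ 2 + Lω ^ 2) * B ^ 2 * α ^ 2 / (lam * β)
        + 4 * (Lω ^ 2 * lam) * B ^ 2 * α ^ 2 / (lam * β) := by
    rw [← add_div]
    ring
  have p1 : 0 ≤ B * A * T ^ 2 * (β * b) := by positivity
  have p2 : 0 ≤ lam * A * T ^ 2 * (β * b) := by positivity
  have p3 : 0 ≤ B ^ 2 * T ^ 2 * (β * b) := by positivity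
  rw [n6]
  rw [hq] at y2 n2
  linarith

/-! ### The two-time-scale iterates -/

section Iterates

variable {S Ω : Type*} [MeasurableSpace S] {mΩ : MeasurableSpace Ω} {d r : ℕ}
  {c : Constants} {f : E d → ℝ} {F : E d → E r → S → E d} {G : E d → E r → S → E r}
  {P : E d → Kernel S S} {π : E d → Measure S} {ωstar : E d → E r} {cα cβ : ℝ}
  {Pr : Measure Ω} {ℱ : Filtration ℕ mΩ} {X : ℕ → Ω → S}
  {θ : ℕ → Ω → E d} {ω : ℕ → Ω → E r}

/-- The problem data together with a run of the algorithm, in recursive form. -/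
structure System {S Ω : Type*} [MeasurableSpace S] {mΩ : MeasurableSpace Ω} {d r : ℕ}
    (c : Constants) (f : E d → ℝ) (F : E d → E r → S → E d) (G : E d → E r → S → E r)
    (P : E d → Kernel S S) (π : E d → Measure S) (ωstar : E d → E r) (cα cβ : ℝ)
    (Pr : Measure Ω) (ℱ : Filtration ℕ mΩ) (X : ℕ → Ω → S)
    (θ : ℕ → Ω → E d) (ω : ℕ → Ω → E r) : Prop where
  valid : c.Valid
  data : Assumptions c f F G P π ωstar
  cα_pos : 0 < cα
  cβ_pos : 0 < cβ
  prob : IsProbabilityMeasure Pr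
  chain : IsControlledChain P Pr ℱ X θ
  init : ∃ θ₀ ω₀, (∀ o, θ 0 o = θ₀) ∧ ∀ o, ω 0 o = ω₀
  θ_succ : ∀ k o, θ (k + 1) o = θ k o - stepα cα k • F (θ k o) (ω k o) (X k o)
  ω_succ : ∀ k o, ω (k + 1) o = ω k o + stepβ cβ k • G (θ (k + 1) o) (ω k o) (X k o)
  G_bdd : ∀ᵐ o ∂Pr, ∀ k x, ‖G (θ k o) (ω k o) x‖ ≤ c.B ∧ ‖G (θ (k + 1) o) (ω k o) x‖ ≤ c.B

/-- The average of `G θ w` under the stationary distribution of the parameter `θ`. -/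
noncomputable def meanG (G : E d → E r → S → E r) (π : E d → Measure S) (θ : E d) (w : E r) : E r :=
  ∫ x, G θ w x ∂(π θ)

namespace Assumptions

variable (hA : Assumptions c f F G P π ωstar)
include hA

theorem norm_gradient_le (x : E d) : ‖gradient f x‖ ≤ c.B := by
  have := hA.prob x
  rw [hA.grad_eq]
  simpa using norm_integral_le_of_norm_le_const (μ := π x) (ae_of_all _ (hA.F_bdd x (ωstar x)))

theorem continuous_gradient : Continuous (gradient f) := by
  have : LipschitzWith c.Lf.toNNReal (gradient f) := LipschitzWith.of_dist_le_mul fun x y => by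
    rw [dist_eq_norm, dist_eq_norm]
    exact (hA.f_smooth x y).trans
      (mul_le_mul_of_nonneg_right (Real.le_coe_toNNReal _) (norm_nonneg _))
  exact this.continuous

theorem continuous_ωstar : Continuous ωstar := by
  have : LipschitzWith c.Lω.toNNReal ωstar := LipschitzWith.of_dist_le_mul fun x y => by
    rw [dist_eq_norm, dist_eq_norm]
    exact (hA.ωstar_lip x y).trans
      (mul_le_mul_of_nonneg_right (Real.le_coe_toNNReal _) (norm_nonneg _))
  exact this.continuous

theorem measurable_F : Measurable fun q : (E d × E r) × S => F q.1.1 q.1.2 q.2 := by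
  refine measurable_uncurry_of_continuous_of_measurable (u := fun p : E d × E r => F p.1 p.2)
    (fun x => ?_) (fun p => hA.F_meas _ _)
  refine continuous_iff_continuousAt.2 fun p => tendsto_iff_norm_sub_tendsto_zero.2 ?_
  refine squeeze_zero (fun _ => norm_nonneg _) (fun q => hA.F_lip q.1 p.1 q.2 p.2 x) ?_
  have : Continuous fun q : E d × E r => c.LF * (‖q.1 - p.1‖ + ‖q.2 - p.2‖) := by fun_prop
  simpa using this.tendsto p

theorem measurable_G : Measurable fun q : (E d × E r) × S => G q.1.1 q.1.2 q.2 := by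
  refine measurable_uncurry_of_continuous_of_measurable (u := fun p : E d × E r => G p.1 p.2)
    (fun x => ?_) (fun p => hA.G_meas _ _)
  refine continuous_iff_continuousAt.2 fun p => tendsto_iff_norm_sub_tendsto_zero.2 ?_
  refine squeeze_zero (fun _ => norm_nonneg _) (fun q => hA.G_lip q.1 p.1 q.2 p.2 x) ?_
  have : Continuous fun q : E d × E r => c.LG * (‖q.1 - p.1‖ + ‖q.2 - p.2‖) := by fun_prop
  simpa using this.tendsto p

theorem measurable_meanG : Measurable fun p : E d × E r => meanG G π p.1 p.2 := by
  have h := (hA.measurable_G.stronglyMeasurable.integral_kernel_prod_right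
    (κ := (paramMeasure π hA.prob hA.π_lip).comap Prod.fst measurable_fst)
    (f := fun (p : E d × E r) x => G p.1 p.2 x)).measurable
  simpa [Kernel.comap_apply, paramMeasure_apply, meanG] using h

theorem norm_meanG_le {x : E d} {w : E r} (h : ∀ y, ‖G x w y‖ ≤ c.B) : ‖meanG G π x w‖ ≤ c.B := by
  have := hA.prob x
  simpa [meanG] using norm_integral_le_of_norm_le_const (μ := π x) (ae_of_all _ h)

theorem inner_meanG (x : E d) {x' : E d} {w : E r} (h : ∀ y, ‖G x w y‖ ≤ c.B) (v : E r) :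
    ∫ y, inner ℝ v (G x w y) ∂(π x') = inner ℝ v (∫ y, G x w y ∂(π x')) := by
  have := hA.prob x'
  exact integral_inner (Integrable.of_bound (hA.G_meas x w).aestronglyMeasurable c.B
    (ae_of_all _ h)) v

/-- Strong monotonicity of the mean field, since `meanG` vanishes at `ωstar θ`. -/
theorem inner_meanG_le {x : E d} {w : E r} (h : ∀ y, ‖G x w y‖ ≤ c.B) :
    inner ℝ (w - ωstar x) (meanG G π x w) ≤ -c.lamG * ‖w - ωstar x‖ ^ 2 := by
  have := hA.prob x
  have hi1 : Integrable (G x w) (π x) :=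
    Integrable.of_bound (hA.G_meas x w).aestronglyMeasurable c.B (ae_of_all _ h)
  have hi2 : Integrable (G x (ωstar x)) (π x) := by
    refine Integrable.of_bound (hA.G_meas x _).aestronglyMeasurable
      (c.B + c.LG * (‖x - x‖ + ‖ωstar x - w‖)) (ae_of_all _ fun y => ?_)
    have h1 := hA.G_lip x x (ωstar x) w y
    have h2 := norm_le_norm_add_norm_sub' (G x (ωstar x) y) (G x w y)
    linarith [h y]
  have hm := hA.G_mono x w
  have e : ∫ y, inner ℝ (w - ωstar x) (G x w y - G x (ωstar x) y) ∂(π x)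
      = inner ℝ (w - ωstar x) (meanG G π x w) := by
    rw [integral_inner (f := fun y => G x w y - G x (ωstar x) y) (hi1.sub hi2) (w - ωstar x),
      integral_sub hi1 hi2, hA.ωstar_eq, sub_zero, meanG]
  rwa [e] at hm

/-- Regularity of the mean field: the change of the stationary distribution costs a total variation
distance, and the change of the integrand is controlled by the Lipschitz constant of `G`. -/
theorem inner_meanG_sub_le (hc : c.Valid) {x x' : E d} {w w' : E r}
    (h : ∀ y, ‖G x w y‖ ≤ c.B) (h' : ∀ y, ‖G x' w' y‖ ≤ c.B) (v : E r) :
    inner ℝ v (meanG G π x w) - inner ℝ v (meanG G π x' w')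
      ≤ ‖v‖ * (2 * c.B * c.Lμ * ‖x - x'‖ + c.LG * (‖x - x'‖ + ‖w - w'‖)) := by
  have := hA.prob x
  have := hA.prob x'
  have hB : ∀ y, |inner ℝ v (G x w y)| ≤ ‖v‖ * c.B := fun y =>
    (abs_real_inner_le_norm _ _).trans (mul_le_mul_of_nonneg_left (h y) (norm_nonneg _))
  have hm : Measurable fun y => inner ℝ v (G x w y) := measurable_const.inner (hA.G_meas x w)
  have h1 := abs_integral_sub_le_tvDist (μ := π x) (ν := π x') hm hB
  have h2 := hA.π_lip x x'
  rw [hA.inner_meanG x h, hA.inner_meanG x h] at h1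
  have h3 : inner ℝ v (∫ y, G x w y ∂(π x')) - inner ℝ v (∫ y, G x' w' y ∂(π x'))
      ≤ ‖v‖ * (c.LG * (‖x - x'‖ + ‖w - w'‖)) := by
    rw [← inner_sub_right, ← integral_sub
      (Integrable.of_bound (hA.G_meas x w).aestronglyMeasurable c.B (ae_of_all _ h))
      (Integrable.of_bound (hA.G_meas x' w').aestronglyMeasurable c.B (ae_of_all _ h'))]
    refine (real_inner_le_norm _ _).trans (mul_le_mul_of_nonneg_left ?_ (norm_nonneg _))
    simpa using norm_integral_le_of_norm_le_const (μ := π x')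
      (ae_of_all _ fun y => hA.G_lip x x' w w' y)
  have h4 := (le_abs_self _).trans h1
  have h5 : 2 * (‖v‖ * c.B) * tvDist (π x) (π x') ≤ 2 * (‖v‖ * c.B) * (c.Lμ * ‖x - x'‖) :=
    mul_le_mul_of_nonneg_left h2 (by have := hc.B_pos; positivity)
  unfold meanG
  linarith

end Assumptions

namespace System

variable (h : System c f F G P π ωstar cα cβ Pr ℱ X θ ω)
include h

theorem measurable_X (k : ℕ) : Measurable (X k) := (h.chain.adapted k).mono (ℱ.le k) le_rfl

theorem measurable_step (k : ℕ) (h0 : Measurable[ℱ k] (θ k)) (h1 : Measurable[ℱ k] (ω k)) :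
    Measurable[ℱ k] (θ (k + 1)) ∧ Measurable[ℱ k] (ω (k + 1)) := by
  have hF : Measurable[ℱ k] fun o => F (θ k o) (ω k o) (X k o) :=
    h.data.measurable_F.comp ((h0.prodMk h1).prodMk (h.chain.adapted k))
  have hθ : Measurable[ℱ k] (θ (k + 1)) := by
    have e : θ (k + 1) = fun o => θ k o - stepα cα k • F (θ k o) (ω k o) (X k o) :=
      funext (h.θ_succ k)
    rw [e]
    exact h0.sub (hF.const_smul (stepα cα k))
  have hG : Measurable[ℱ k] fun o => G (θ (k + 1) o) (ω k o) (X k o) :=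
    h.data.measurable_G.comp ((hθ.prodMk h1).prodMk (h.chain.adapted k))
  refine ⟨hθ, ?_⟩
  have e : ω (k + 1) = fun o => ω k o + stepβ cβ k • G (θ (k + 1) o) (ω k o) (X k o) :=
    funext (h.ω_succ k)
  rw [e]
  exact h1.add (hG.const_smul (stepβ cβ k))

theorem measurable_filtration (k : ℕ) : Measurable[ℱ k] (θ k) ∧ Measurable[ℱ k] (ω k) := by
  induction k with
  | zero =>
    obtain ⟨θ₀, ω₀, h0, h1⟩ := h.init
    rw [show θ 0 = fun _ => θ₀ from funext h0, show ω 0 = fun _ => ω₀ from funext h1]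
    exact ⟨measurable_const, measurable_const⟩
  | succ k ih =>
    have := h.measurable_step k ih.1 ih.2
    exact ⟨this.1.mono (ℱ.mono (Nat.le_succ k)) le_rfl,
      this.2.mono (ℱ.mono (Nat.le_succ k)) le_rfl⟩

theorem measurable_θ_succ (k : ℕ) : Measurable[ℱ k] (θ (k + 1)) :=
  (h.measurable_step k (h.measurable_filtration k).1 (h.measurable_filtration k).2).1

theorem measurable_θ (k : ℕ) : Measurable (θ k) :=
  (h.measurable_filtration k).1.mono (ℱ.le k) le_rfl

theorem measurable_ω (k : ℕ) : Measurable (ω k) :=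
  (h.measurable_filtration k).2.mono (ℱ.le k) le_rfl

theorem measurable_z (k : ℕ) : Measurable fun o => ω k o - ωstar (θ k o) :=
  (h.measurable_ω k).sub (h.data.continuous_ωstar.measurable.comp (h.measurable_θ k))

theorem norm_θ_step (k : ℕ) (o : Ω) : ‖θ (k + 1) o - θ k o‖ ≤ c.B * stepα cα k := by
  rw [h.θ_succ, sub_sub_cancel_left, norm_neg, norm_smul,
    Real.norm_of_nonneg (stepα_pos h.cα_pos k).le, mul_comm]
  exact mul_le_mul_of_nonneg_right (h.data.F_bdd _ _ _) (stepα_pos h.cα_pos k).le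

theorem norm_θ_sub (s i : ℕ) (o : Ω) : ‖θ (s + i) o - θ s o‖ ≤ c.B * stepα cα s * i := by
  induction i with
  | zero => simp
  | succ i ih =>
    have h1 := h.norm_θ_step (s + i) o
    have h2 := mul_le_mul_of_nonneg_left
      (stepα_antitone h.cα_pos (Nat.le_add_right s i)) h.valid.B_pos.le
    have h3 := norm_sub_le_norm_sub_add_norm_sub (θ (s + i + 1) o) (θ (s + i) o) (θ s o)
    push_cast
    rw [← add_assoc]
    linarith

theorem norm_ω_step {o : Ω}
    (ho : ∀ k x, ‖G (θ k o) (ω k o) x‖ ≤ c.B ∧ ‖G (θ (k + 1) o) (ω k o) x‖ ≤ c.B) (k : ℕ) :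
    ‖ω (k + 1) o - ω k o‖ ≤ c.B * stepβ cβ k := by
  rw [h.ω_succ, add_sub_cancel_left, norm_smul,
    Real.norm_of_nonneg (stepβ_pos h.cβ_pos k).le, mul_comm]
  exact mul_le_mul_of_nonneg_right (ho k _).2 (stepβ_pos h.cβ_pos k).le

theorem norm_ω_sub {o : Ω}
    (ho : ∀ k x, ‖G (θ k o) (ω k o) x‖ ≤ c.B ∧ ‖G (θ (k + 1) o) (ω k o) x‖ ≤ c.B) (s i : ℕ) :
    ‖ω (s + i) o - ω s o‖ ≤ c.B * stepβ cβ s * i := by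
  induction i with
  | zero => simp
  | succ i ih =>
    have h1 := h.norm_ω_step ho (s + i)
    have h2 := mul_le_mul_of_nonneg_left
      (stepβ_antitone h.cβ_pos (Nat.le_add_right s i)) h.valid.B_pos.le
    have h3 := norm_sub_le_norm_sub_add_norm_sub (ω (s + i + 1) o) (ω (s + i) o) (ω s o)
    push_cast
    rw [← add_assoc]
    linarith

/-- The tracking error drifts by at most `A * β_s` per step. Here and below `A` is any majorant of
`B * (1 + Lω * cα / cβ)`: for `cα ≤ cβ` it can be chosen free of the ratio. -/
theorem norm_z_sub {o : Ω}
    (ho : ∀ k x, ‖G (θ k o) (ω k o) x‖ ≤ c.B ∧ ‖G (θ (k + 1) o) (ω k o) x‖ ≤ c.B)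
    {A : ℝ} (hA : c.B * (1 + c.Lω * (cα / cβ)) ≤ A) (s i : ℕ) :
    ‖(ω (s + i) o - ωstar (θ (s + i) o)) - (ω s o - ωstar (θ s o))‖ ≤ A * stepβ cβ s * i := by
  have h1 := h.norm_ω_sub ho s i
  have h2 := (h.data.ωstar_lip (θ (s + i) o) (θ s o)).trans
    (mul_le_mul_of_nonneg_left (h.norm_θ_sub s i o) h.valid.Lω_nonneg)
  have h3 := stepα_le_stepβ h.cα_pos h.cβ_pos s
  have h4 : c.Lω * (c.B * stepα cα s * i) ≤ c.Lω * (c.B * (cα / cβ * stepβ cβ s) * i) := by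
    have := h.valid.Lω_nonneg
    have := h.valid.B_pos.le
    gcongr
  have h5 := mul_le_mul_of_nonneg_right hA
    (mul_nonneg (stepβ_pos h.cβ_pos s).le (Nat.cast_nonneg (α := ℝ) i))
  have h6 : ‖(ω (s + i) o - ωstar (θ (s + i) o)) - (ω s o - ωstar (θ s o))‖
      ≤ ‖ω (s + i) o - ω s o‖ + ‖ωstar (θ (s + i) o) - ωstar (θ s o)‖ := by
    rw [sub_sub_sub_comm]
    exact norm_sub_le _ _
  linarith

theorem norm_z_le {o : Ω}
    (ho : ∀ k x, ‖G (θ k o) (ω k o) x‖ ≤ c.B ∧ ‖G (θ (k + 1) o) (ω k o) x‖ ≤ c.B)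
    {A : ℝ} (hA : c.B * (1 + c.Lω * (cα / cβ)) ≤ A) (s i : ℕ) :
    ‖ω s o - ωstar (θ s o)‖ ≤ ‖ω (s + i) o - ωstar (θ (s + i) o)‖ + A * stepβ cβ s * i := by
  have h1 := h.norm_z_sub ho hA s i
  have h2 := norm_le_norm_add_norm_sub (ω (s + i) o - ωstar (θ (s + i) o)) (ω s o - ωstar (θ s o))
  linarith

/-! ### Integrability -/

/-- The tracking error grows at most linearly, almost surely. -/
theorem exists_norm_z_le : ∃ R, 0 ≤ R ∧ ∀ᵐ o ∂Pr, ∀ k : ℕ,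
    ‖ω k o - ωstar (θ k o)‖ ≤ R * (k + 1) := by
  obtain ⟨θ₀, ω₀, h0, h1⟩ := h.init
  have hA : 0 ≤ c.B * (1 + c.Lω * (cα / cβ)) := by
    have := h.valid.B_pos; have := h.valid.Lω_nonneg; have := h.cα_pos; have := h.cβ_pos
    positivity
  have hβ := (stepβ_pos h.cβ_pos 0).le
  refine ⟨‖ω₀ - ωstar θ₀‖ + c.B * (1 + c.Lω * (cα / cβ)) * stepβ cβ 0, by positivity, ?_⟩
  filter_upwards [h.G_bdd] with o ho k
  have h2 := h.norm_z_sub ho le_rfl 0 k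
  rw [zero_add, h0, h1] at h2
  have h3 := norm_le_norm_add_norm_sub' (ω k o - ωstar (θ k o)) (ω₀ - ωstar θ₀)
  nlinarith [norm_nonneg (ω₀ - ωstar θ₀), mul_nonneg hA hβ, Nat.cast_nonneg (α := ℝ) k,
    mul_nonneg (norm_nonneg (ω₀ - ωstar θ₀)) (Nat.cast_nonneg (α := ℝ) k)]

theorem integrable_norm_z (k : ℕ) : Integrable (fun o => ‖ω k o - ωstar (θ k o)‖) Pr := by
  have := h.prob
  obtain ⟨R, -, hR⟩ := h.exists_norm_z_le
  exact Integrable.of_bound (h.measurable_z k).norm.aestronglyMeasurable (R * (k + 1))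
    (hR.mono fun o ho => by simpa using ho k)

theorem integrable_norm_z_sq (k : ℕ) : Integrable (fun o => ‖ω k o - ωstar (θ k o)‖ ^ 2) Pr := by
  have := h.prob
  obtain ⟨R, -, hR⟩ := h.exists_norm_z_le
  exact Integrable.of_bound ((h.measurable_z k).norm.pow_const 2).aestronglyMeasurable
    ((R * (k + 1)) ^ 2) (hR.mono fun o ho => by
      simpa using pow_le_pow_left₀ (norm_nonneg _) (ho k) 2)

theorem measurable_gradient (k : ℕ) : Measurable fun o => gradient f (θ k o) :=
  h.data.continuous_gradient.measurable.comp (h.measurable_θ k)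

theorem integrable_norm_gradient_sq (k : ℕ) :
    Integrable (fun o => ‖gradient f (θ k o)‖ ^ 2) Pr := by
  have := h.prob
  exact Integrable.of_bound ((h.measurable_gradient k).norm.pow_const 2).aestronglyMeasurable
    (c.B ^ 2) (ae_of_all _ fun o => by
      simpa using pow_le_pow_left₀ (norm_nonneg _) (h.data.norm_gradient_le (θ k o)) 2)

theorem exists_abs_f_le : ∃ R, 0 ≤ R ∧ ∀ (k : ℕ) o, |f (θ k o)| ≤ R * (k + 1) := by
  obtain ⟨θ₀, ω₀, h0, h1⟩ := h.init
  have hB := h.valid.B_pos.le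
  have hα := (stepα_pos h.cα_pos 0).le
  refine ⟨|f θ₀| + c.B * (c.B * stepα cα 0), by positivity, fun k o => ?_⟩
  have h2 := abs_sub_le_of_norm_gradient_le h.data.f_diff h.data.norm_gradient_le (θ k o) θ₀
  have h3 := h.norm_θ_sub 0 k o
  rw [zero_add, h0] at h3
  have h4 := mul_le_mul_of_nonneg_left h3 hB
  have h5 : |f (θ k o)| ≤ |f θ₀| + |f (θ k o) - f θ₀| := by
    have := abs_add_le (f θ₀) (f (θ k o) - f θ₀)
    rwa [add_sub_cancel] at this
  nlinarith [mul_nonneg (abs_nonneg (f θ₀)) (Nat.cast_nonneg (α := ℝ) k),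
    mul_nonneg hB (mul_nonneg hB hα)]

theorem integrable_f (k : ℕ) : Integrable (fun o => f (θ k o)) Pr := by
  have := h.prob
  obtain ⟨R, -, hR⟩ := h.exists_abs_f_le
  exact Integrable.of_bound
    (h.data.f_diff.continuous.measurable.comp (h.measurable_θ k)).aestronglyMeasurable
    (R * (k + 1)) (ae_of_all _ fun o => by simpa using hR k o)

/-! ### Markovian noise -/

theorem measurable_inner_gradient_F :
    Measurable (Function.uncurry fun x y => inner ℝ (gradient f x) (F x (ωstar x) y)) := by
  have h1 : Measurable fun p : E d × S => ((p.1, ωstar p.1), p.2) :=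
    (measurable_fst.prodMk (h.data.continuous_ωstar.measurable.comp measurable_fst)).prodMk
      measurable_snd
  exact (h.data.continuous_gradient.measurable.comp measurable_fst).inner
    (h.data.measurable_F.comp h1)

theorem abs_inner_gradient_F_le (x : E d) (y : S) :
    |inner ℝ (gradient f x) (F x (ωstar x) y)| ≤ c.B ^ 2 := by
  rw [sq]
  exact (abs_real_inner_le_norm _ _).trans (mul_le_mul (h.data.norm_gradient_le x)
    (h.data.F_bdd _ _ _) (norm_nonneg _) h.valid.B_pos.le)

theorem integral_inner_gradient_F (x : E d) :
    ∫ y, inner ℝ (gradient f x) (F x (ωstar x) y) ∂(π x) = ‖gradient f x‖ ^ 2 := by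
  have := h.data.prob x
  rw [integral_inner (Integrable.of_bound (h.data.F_meas x (ωstar x)).aestronglyMeasurable c.B
    (ae_of_all _ (h.data.F_bdd _ _))), ← h.data.grad_eq, real_inner_self_eq_norm_sq]

theorem integrable_inner_gradient_F (i j : ℕ) :
    Integrable (fun o => inner ℝ (gradient f (θ i o)) (F (θ i o) (ωstar (θ i o)) (X j o))) Pr := by
  have := h.prob
  exact Integrable.of_bound (h.measurable_inner_gradient_F.comp
    ((h.measurable_θ i).prodMk (h.measurable_X j))).aestronglyMeasurable (c.B ^ 2)
    (ae_of_all _ fun o => h.abs_inner_gradient_F_le _ _)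

/-- The deviation of `⟨∇f, F⟩` from its stationary mean is Lipschitz in the parameter. -/
theorem abs_gradientNoise_sub_le (x x' : E d) (y : S) :
    |(inner ℝ (gradient f x) (F x (ωstar x) y) - ‖gradient f x‖ ^ 2)
      - (inner ℝ (gradient f x') (F x' (ωstar x') y) - ‖gradient f x'‖ ^ 2)|
      ≤ c.B * (3 * c.Lf + c.LF * (c.Lω + 1)) * ‖x - x'‖ := by
  have hB := h.valid.B_pos.le
  have e : (inner ℝ (gradient f x) (F x (ωstar x) y) - ‖gradient f x‖ ^ 2)
      - (inner ℝ (gradient f x') (F x' (ωstar x') y) - ‖gradient f x'‖ ^ 2)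
      = inner ℝ (gradient f x - gradient f x') (F x (ωstar x) y)
        + inner ℝ (gradient f x') (F x (ωstar x) y - F x' (ωstar x') y)
        - inner ℝ (gradient f x - gradient f x') (gradient f x)
        - inner ℝ (gradient f x') (gradient f x - gradient f x') := by
    simp only [inner_sub_left, inner_sub_right, real_inner_self_eq_norm_sq]
    ring
  have hs := h.data.f_smooth x x'
  have h1 := (abs_real_inner_le_norm (gradient f x - gradient f x') (F x (ωstar x) y)).trans
    (mul_le_mul hs (h.data.F_bdd x (ωstar x) y) (norm_nonneg _)
      (mul_nonneg h.valid.Lf_nonneg (norm_nonneg _)))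
  have h2 := (abs_real_inner_le_norm (gradient f x') (F x (ωstar x) y - F x' (ωstar x') y)).trans
    (mul_le_mul (h.data.norm_gradient_le x') ((h.data.F_lip x x' (ωstar x) (ωstar x') y).trans
      (mul_le_mul_of_nonneg_left (add_le_add_right (h.data.ωstar_lip x x') _) h.valid.LF_nonneg))
      (norm_nonneg _) hB)
  have h3 := (abs_real_inner_le_norm (gradient f x - gradient f x') (gradient f x)).trans
    (mul_le_mul hs (h.data.norm_gradient_le x) (norm_nonneg _)
      (mul_nonneg h.valid.Lf_nonneg (norm_nonneg _)))
  have h4 := (abs_real_inner_le_norm (gradient f x') (gradient f x - gradient f x')).trans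
    (mul_le_mul (h.data.norm_gradient_le x') hs (norm_nonneg _) hB)
  rw [abs_le] at h1 h2 h3 h4
  rw [e, abs_le]
  constructor <;> linarith [h1.1, h1.2, h2.1, h2.2, h3.1, h3.2, h4.1, h4.2]

/-- The bias of the gradient estimate caused by the Markovian sampling. -/
theorem abs_gradientNoise_le {s τ : ℕ} (hτ : 1 ≤ τ) (hmix : c.m * c.ρ ^ τ ≤ stepα cα (s + τ)) :
    |∫ o, (inner ℝ (gradient f (θ (s + τ) o)) (F (θ (s + τ) o) (ωstar (θ (s + τ) o)) (X (s + τ) o))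
      - ‖gradient f (θ (s + τ) o)‖ ^ 2) ∂Pr|
      ≤ stepα cα s * (2 * C₁ c * c.B * τ ^ 2 + 2 * c.B ^ 2) := by
  have := h.prob
  have hα := (stepα_pos h.cα_pos s).le
  have hB := h.valid.B_pos.le
  have hτ' : (1 : ℝ) ≤ τ := by exact_mod_cast hτ
  have hm := abs_integral_sub_stationary_le h.data.markov h.valid.LTV_nonneg h.data.P_lip
    h.data.prob h.data.π_lip h.chain h.measurable_θ_succ (s := s) (τ := τ)
    (h.measurable_filtration s).1 measurable_id (fun _ => rfl) (h.norm_θ_sub s)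
    (ε := stepα cα s) (fun x y => (h.data.mixing x y τ).trans
      (hmix.trans (stepα_antitone h.cα_pos (Nat.le_add_right s τ))))
    h.measurable_inner_gradient_F (integrable_const (c.B ^ 2))
    (ae_of_all _ fun o y => h.abs_inner_gradient_F_le _ _)
  simp only [h.integral_inner_gradient_F, integral_const, probReal_univ, one_smul] at hm
  have hi := fun i => (h.integrable_inner_gradient_F i (s + τ)).sub (h.integrable_norm_gradient_sq i)
  rw [← integral_sub (h.integrable_inner_gradient_F s (s + τ))
    (h.integrable_norm_gradient_sq s)] at hm
  have hd : |∫ o, (inner ℝ (gradient f (θ (s + τ) o))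
        (F (θ (s + τ) o) (ωstar (θ (s + τ) o)) (X (s + τ) o)) - ‖gradient f (θ (s + τ) o)‖ ^ 2) ∂Pr
      - ∫ o, (inner ℝ (gradient f (θ s o)) (F (θ s o) (ωstar (θ s o)) (X (s + τ) o))
        - ‖gradient f (θ s o)‖ ^ 2) ∂Pr|
      ≤ c.B * (3 * c.Lf + c.LF * (c.Lω + 1)) * (c.B * stepα cα s * τ) := by
    have e := integral_sub (hi (s + τ)) (hi s)
    simp only [Pi.sub_apply] at e
    rw [← e]
    have hb : ∀ o, ‖(inner ℝ (gradient f (θ (s + τ) o))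
        (F (θ (s + τ) o) (ωstar (θ (s + τ) o)) (X (s + τ) o)) - ‖gradient f (θ (s + τ) o)‖ ^ 2)
      - (inner ℝ (gradient f (θ s o)) (F (θ s o) (ωstar (θ s o)) (X (s + τ) o))
        - ‖gradient f (θ s o)‖ ^ 2)‖
      ≤ c.B * (3 * c.Lf + c.LF * (c.Lω + 1)) * (c.B * stepα cα s * τ) := fun o => by
      refine (h.abs_gradientNoise_sub_le _ _ _).trans
        (mul_le_mul_of_nonneg_left (h.norm_θ_sub s τ o) ?_)
      have := h.valid.Lf_nonneg; have := h.valid.LF_nonneg; have := h.valid.Lω_nonneg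
      positivity
    simpa using norm_integral_le_of_norm_le_const (μ := Pr) (ae_of_all _ hb)
  refine (abs_le.2 ?_ : |_| ≤ (c.LTV * (c.B * stepα cα s) * (τ * (τ + 1)) + 2 * stepα cα s) * c.B ^ 2
    + c.B * (3 * c.Lf + c.LF * (c.Lω + 1)) * (c.B * stepα cα s * τ)).trans ?_
  · rw [abs_le] at hm hd
    constructor <;> linarith [hm.1, hm.2, hd.1, hd.2]
  · have t1 : (τ : ℝ) ≤ (τ : ℝ) ^ 2 := by nlinarith
    have t2 : (τ : ℝ) * (τ + 1) ≤ 2 * (τ : ℝ) ^ 2 := by nlinarith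
    have a1 := mul_le_mul_of_nonneg_left t2
      (by have := h.valid.LTV_nonneg; positivity : 0 ≤ c.LTV * c.B ^ 3 * stepα cα s)
    have a2 := mul_le_mul_of_nonneg_left t1
      (by have := h.valid.Lf_nonneg; have := h.valid.LF_nonneg; have := h.valid.Lω_nonneg; positivity :
        0 ≤ c.B ^ 2 * (3 * c.Lf + c.LF * (c.Lω + 1)) * stepα cα s)
    have a3 : 0 ≤ c.B ^ 2 * c.Lf * stepα cα s * (τ : ℝ) ^ 2 := by
      have := h.valid.Lf_nonneg; positivity
    have a4 : 0 ≤ c.B ^ 2 * (c.LF * (c.Lω + 1)) * stepα cα s * (τ : ℝ) ^ 2 := by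
      have := h.valid.LF_nonneg; have := h.valid.Lω_nonneg; positivity
    have a5 : 0 ≤ c.B ^ 3 * c.LTV * stepα cα s * (τ : ℝ) ^ 2 := by
      have := h.valid.LTV_nonneg; positivity
    have a6 : 0 ≤ c.B ^ 3 * c.Lμ * stepα cα s * (τ : ℝ) ^ 2 := by
      have := h.valid.Lμ_nonneg; positivity
    unfold C₁
    linarith

theorem integrable_inner_z_G (i j k : ℕ) : Integrable (fun o =>
    inner ℝ (ω i o - ωstar (θ i o)) (G (θ j o) (ω j o) (X k o) - meanG G π (θ j o) (ω j o))) Pr := by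
  have hm : Measurable fun o =>
      inner ℝ (ω i o - ωstar (θ i o)) (G (θ j o) (ω j o) (X k o) - meanG G π (θ j o) (ω j o)) :=
    (h.measurable_z i).inner
      ((h.data.measurable_G.comp (((h.measurable_θ j).prodMk (h.measurable_ω j)).prodMk
        (h.measurable_X k))).sub
        (h.data.measurable_meanG.comp ((h.measurable_θ j).prodMk (h.measurable_ω j))))
  refine ((h.integrable_norm_z i).mul_const (2 * c.B)).mono' hm.aestronglyMeasurable ?_
  filter_upwards [h.G_bdd] with o ho
  refine (norm_inner_le_norm _ _).trans (mul_le_mul_of_nonneg_left ?_ (norm_nonneg _))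
  have h1 := norm_sub_le (G (θ j o) (ω j o) (X k o)) (meanG G π (θ j o) (ω j o))
  have h2 := h.data.norm_meanG_le (fun x => (ho j x).1)
  linarith [(ho j (X k o)).1]

/-- The bias in the tracking direction caused by the Markovian sampling, in terms of the tracking
error at the earlier time `s`. The mixing error `2 * B * α_s` is absorbed into the constant `D`
through `α_s ≤ (cα / cβ) * β_s`. -/
theorem trackingNoise_le {A D : ℝ} (hA : c.B * (1 + c.Lω * (cα / cβ)) ≤ A)
    (hD : C₂ c cα cβ + 2 * c.B * (cα / cβ) ≤ D) {s τ : ℕ} (hτ : 1 ≤ τ)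
    (hmix : c.m * c.ρ ^ τ ≤ stepα cα (s + τ)) :
    ∫ o, inner ℝ (ω (s + τ) o - ωstar (θ (s + τ) o))
      (G (θ (s + τ) o) (ω (s + τ) o) (X (s + τ) o) - meanG G π (θ (s + τ) o) (ω (s + τ) o)) ∂Pr
      ≤ 2 * c.B * A * τ * stepβ cβ s
        + D * τ ^ 2 * stepβ cβ s * ∫ o, ‖ω s o - ωstar (θ s o)‖ ∂Pr := by
  have := h.prob
  have hα := (stepα_pos h.cα_pos s).le
  have hβ := (stepβ_pos h.cβ_pos s).le
  have hB := h.valid.B_pos.le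
  have hLG := h.valid.LG_nonneg
  have hLμ := h.valid.Lμ_nonneg
  have hLTV := h.valid.LTV_nonneg
  have hτ' : (1 : ℝ) ≤ τ := by exact_mod_cast hτ
  set t := s + τ with ht
  set Zs := ∫ o, ‖ω s o - ωstar (θ s o)‖ ∂Pr with hZs
  have hZs0 : 0 ≤ Zs := integral_nonneg fun o => norm_nonneg _
  set H : E d × E r → S → ℝ := fun q y => inner ℝ (q.2 - ωstar q.1) (G q.1 q.2 y) with hH
  have hHm : Measurable (Function.uncurry H) := by
    have h1 : Measurable fun p : (E d × E r) × S => p.1.2 - ωstar p.1.1 :=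
      (measurable_snd.comp measurable_fst).sub (h.data.continuous_ωstar.measurable.comp
        (measurable_fst.comp measurable_fst))
    exact h1.inner h.data.measurable_G
  have hm := abs_integral_sub_stationary_le h.data.markov h.valid.LTV_nonneg h.data.P_lip
    h.data.prob h.data.π_lip h.chain h.measurable_θ_succ (s := s) (τ := τ)
    ((h.measurable_filtration s).1.prodMk (h.measurable_filtration s).2) measurable_fst
    (fun _ => rfl) (h.norm_θ_sub s)
    (ε := stepα cα s) (fun x y => (h.data.mixing x y τ).trans
      (hmix.trans (stepα_antitone h.cα_pos (Nat.le_add_right s τ))))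
    hHm ((h.integrable_norm_z s).mul_const c.B)
    (h.G_bdd.mono fun o ho y => (abs_real_inner_le_norm _ _).trans
      (mul_le_mul_of_nonneg_left (ho s y).1 (norm_nonneg _)))
  rw [integral_mul_const, ← hZs, ← ht] at hm
  -- the noise at the earlier iterates, integrated
  have hmean : ∫ o, ∫ y, H (θ s o, ω s o) y ∂(π (θ s o)) ∂Pr
      = ∫ o, inner ℝ (ω s o - ωstar (θ s o)) (meanG G π (θ s o) (ω s o)) ∂Pr :=
    integral_congr_ae (h.G_bdd.mono fun o ho =>
      h.data.inner_meanG (θ s o) (fun y => (ho s y).1) _)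
  have hi1 : Integrable (fun o => inner ℝ (ω s o - ωstar (θ s o)) (meanG G π (θ s o) (ω s o))) Pr := by
    refine ((h.integrable_norm_z s).mul_const c.B).mono'
      ((h.measurable_z s).inner (h.data.measurable_meanG.comp
        ((h.measurable_θ s).prodMk (h.measurable_ω s)))).aestronglyMeasurable ?_
    filter_upwards [h.G_bdd] with o ho
    exact (norm_inner_le_norm _ _).trans (mul_le_mul_of_nonneg_left
      (h.data.norm_meanG_le fun x => (ho s x).1) (norm_nonneg _))
  have hsplit : ∫ o, inner ℝ (ω s o - ωstar (θ s o))
      (G (θ s o) (ω s o) (X t o) - meanG G π (θ s o) (ω s o)) ∂Pr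
      = ∫ o, H (θ s o, ω s o) (X t o) ∂Pr - ∫ o, ∫ y, H (θ s o, ω s o) y ∂(π (θ s o)) ∂Pr := by
    have hi2 : Integrable (fun o => H (θ s o, ω s o) (X t o)) Pr := by
      refine ((h.integrable_inner_z_G s s t).add hi1).congr (ae_of_all _ fun o => ?_)
      simp [hH, inner_sub_right]
    rw [hmean, ← integral_sub hi2 hi1]
    simp [hH, inner_sub_right]
  -- the change of the noise between the times `s` and `t`
  set κ := cα / cβ with hκ
  set L := 2 * c.B * c.Lμ * (c.B * stepα cα s * τ)
    + 2 * c.LG * (c.B * stepα cα s * τ + c.B * stepβ cβ s * τ) with hL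
  have hpt : ∀ᵐ o ∂Pr, inner ℝ (ω t o - ωstar (θ t o))
      (G (θ t o) (ω t o) (X t o) - meanG G π (θ t o) (ω t o))
      ≤ 2 * c.B * A * τ * stepβ cβ s
        + (inner ℝ (ω s o - ωstar (θ s o)) (G (θ s o) (ω s o) (X t o) - meanG G π (θ s o) (ω s o))
        + ‖ω s o - ωstar (θ s o)‖ * L) := by
    filter_upwards [h.G_bdd] with o ho
    have hz := h.norm_z_sub ho hA s τ
    have hθ := h.norm_θ_sub s τ o
    have hω := h.norm_ω_sub ho s τ
    rw [← ht] at hz hθ hω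
    set z := ω t o - ωstar (θ t o)
    set z' := ω s o - ωstar (θ s o)
    have e : inner ℝ z (G (θ t o) (ω t o) (X t o) - meanG G π (θ t o) (ω t o))
        = inner ℝ (z - z') (G (θ t o) (ω t o) (X t o) - meanG G π (θ t o) (ω t o))
          + inner ℝ z' (G (θ s o) (ω s o) (X t o) - meanG G π (θ s o) (ω s o))
          + inner ℝ z' (G (θ t o) (ω t o) (X t o) - G (θ s o) (ω s o) (X t o))
          + (inner ℝ z' (meanG G π (θ s o) (ω s o)) - inner ℝ z' (meanG G π (θ t o) (ω t o))) := by
      simp only [inner_sub_left, inner_sub_right]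
      ring
    have h1 : inner ℝ (z - z') (G (θ t o) (ω t o) (X t o) - meanG G π (θ t o) (ω t o))
        ≤ (A * stepβ cβ s * τ) * (2 * c.B) := by
      refine (real_inner_le_norm _ _).trans (mul_le_mul hz ?_ (norm_nonneg _)
        ((norm_nonneg _).trans hz))
      have h1 := norm_sub_le (G (θ t o) (ω t o) (X t o)) (meanG G π (θ t o) (ω t o))
      have h2 := h.data.norm_meanG_le (fun x => (ho t x).1)
      linarith [(ho t (X t o)).1]
    have h2 : inner ℝ z' (G (θ t o) (ω t o) (X t o) - G (θ s o) (ω s o) (X t o))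
        ≤ ‖z'‖ * (c.LG * (c.B * stepα cα s * τ + c.B * stepβ cβ s * τ)) :=
      (real_inner_le_norm _ _).trans (mul_le_mul_of_nonneg_left
        ((h.data.G_lip _ _ _ _ _).trans (mul_le_mul_of_nonneg_left (add_le_add hθ hω) hLG))
        (norm_nonneg _))
    have h3 := h.data.inner_meanG_sub_le h.valid (fun x => (ho s x).1) (fun x => (ho t x).1) z'
    rw [norm_sub_rev (θ s o) (θ t o), norm_sub_rev (ω s o) (ω t o)] at h3
    have h4 : ‖z'‖ * (2 * c.B * c.Lμ * ‖θ t o - θ s o‖ + c.LG * (‖θ t o - θ s o‖ + ‖ω t o - ω s o‖))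
        ≤ ‖z'‖ * (2 * c.B * c.Lμ * (c.B * stepα cα s * τ)
          + c.LG * (c.B * stepα cα s * τ + c.B * stepβ cβ s * τ)) := by gcongr
    rw [e, hL]
    linarith
  have hfin := integral_le_of_ae_le_linear (h.integrable_inner_z_G t t t)
    (h.integrable_inner_z_G s s t) (h.integrable_norm_z s) (integrable_zero _ _ _)
    (p := 1) (q := L) (w := 0) (k := 2 * c.B * A * τ * stepβ cβ s)
    (hpt.mono fun o ho => by linarith)
  rw [← hZs] at hfin
  rw [hsplit] at hfin
  have hm' := (le_abs_self _).trans hm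
  -- collect the constants
  have hαβ := stepα_le_stepβ h.cα_pos h.cβ_pos s
  rw [← hκ] at hαβ
  have hκ0 : 0 ≤ κ := (div_pos h.cα_pos h.cβ_pos).le
  have t1 : (τ : ℝ) ≤ (τ : ℝ) ^ 2 := by nlinarith
  have t2 : (τ : ℝ) * (τ + 1) ≤ 2 * (τ : ℝ) ^ 2 := by nlinarith
  have hD' : (2 * c.LG * c.B + 2 * c.LG * c.B * κ + 2 * c.B ^ 2 * c.LTV * κ
      + 2 * c.B ^ 2 * c.Lμ * κ) + 2 * c.B * κ ≤ D := by
    refine le_trans (le_of_eq ?_) hD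
    rw [hκ]
    unfold C₂
    ring
  have b1 : (c.LTV * (c.B * stepα cα s) * (τ * (τ + 1)) + 2 * stepα cα s) * c.B + L
      ≤ D * τ ^ 2 * stepβ cβ s := by
    calc (c.LTV * (c.B * stepα cα s) * (τ * (τ + 1)) + 2 * stepα cα s) * c.B + L
        ≤ (c.LTV * (c.B * (κ * stepβ cβ s)) * (2 * (τ : ℝ) ^ 2)
            + 2 * (κ * stepβ cβ s) * (τ : ℝ) ^ 2) * c.B
          + (2 * c.B * c.Lμ * (c.B * (κ * stepβ cβ s) * (τ : ℝ) ^ 2)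
            + 2 * c.LG * (c.B * (κ * stepβ cβ s) * (τ : ℝ) ^ 2
              + c.B * stepβ cβ s * (τ : ℝ) ^ 2)) := by
          rw [hL]
          have h1 : 2 * stepα cα s ≤ 2 * (κ * stepβ cβ s) * (τ : ℝ) ^ 2 := by
            nlinarith [mul_nonneg hκ0 hβ]
          gcongr
      _ = ((2 * c.LG * c.B + 2 * c.LG * c.B * κ + 2 * c.B ^ 2 * c.LTV * κ
            + 2 * c.B ^ 2 * c.Lμ * κ) + 2 * c.B * κ) * ((τ : ℝ) ^ 2 * stepβ cβ s) := by ring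
      _ ≤ D * ((τ : ℝ) ^ 2 * stepβ cβ s) := mul_le_mul_of_nonneg_right hD' (by positivity)
      _ = D * τ ^ 2 * stepβ cβ s := by ring
  have b2 := mul_le_mul_of_nonneg_right b1 hZs0
  linarith

/-! ### Drift of the tracking error -/

/-- The drift of the squared tracking error along a path. The three corrections to the contraction
are the motion of the target together with the use of `θ_{t+1}` instead of `θ_t` in `G`, the
Markovian noise, and the squared increment. -/
theorem norm_z_succ_sq_le {o : Ω}
    (ho : ∀ k x, ‖G (θ k o) (ω k o) x‖ ≤ c.B ∧ ‖G (θ (k + 1) o) (ω k o) x‖ ≤ c.B) (t : ℕ) :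
    ‖ω (t + 1) o - ωstar (θ (t + 1) o)‖ ^ 2 ≤
      (1 - 2 * c.lamG * stepβ cβ t) * ‖ω t o - ωstar (θ t o)‖ ^ 2
      + 2 * (c.B * stepα cα t * (c.Lω + c.LG * stepβ cβ t)) * ‖ω t o - ωstar (θ t o)‖
      + 2 * stepβ cβ t * inner ℝ (ω t o - ωstar (θ t o))
          (G (θ t o) (ω t o) (X t o) - meanG G π (θ t o) (ω t o))
      + (2 * c.B ^ 2 * stepβ cβ t ^ 2 + 2 * c.B ^ 2 * c.Lω ^ 2 * stepα cα t ^ 2) := by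
  have hα := (stepα_pos h.cα_pos t).le
  have hβ := (stepβ_pos h.cβ_pos t).le
  have hB := h.valid.B_pos.le
  have hLω := h.valid.Lω_nonneg
  have hθ := h.norm_θ_step t o
  have hg' := (ho t (X t o)).2
  have hmono := h.data.inner_meanG_le (fun x => (ho t x).1)
  have hG := (h.data.G_lip (θ (t + 1) o) (θ t o) (ω t o) (ω t o) (X t o)).trans
    (mul_le_mul_of_nonneg_left (add_le_add_left hθ _) h.valid.LG_nonneg)
  rw [sub_self, norm_zero, add_zero] at hG
  have hδ := (h.data.ωstar_lip (θ t o) (θ (t + 1) o)).trans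
    (mul_le_mul_of_nonneg_left ((norm_sub_rev _ _).trans_le hθ) hLω)
  set z := ω t o - ωstar (θ t o) with hz
  set g := G (θ t o) (ω t o) (X t o)
  set g' := G (θ (t + 1) o) (ω t o) (X t o) with hgdef
  set Gm := meanG G π (θ t o) (ω t o)
  set δ := ωstar (θ t o) - ωstar (θ (t + 1) o) with hδdef
  have e1 : ω (t + 1) o - ωstar (θ (t + 1) o) = z + (stepβ cβ t • g' + δ) := by
    rw [h.ω_succ, hz, hδdef, hgdef]
    abel
  have e2 : inner ℝ z (stepβ cβ t • g' + δ) = stepβ cβ t * inner ℝ z Gm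
      + stepβ cβ t * inner ℝ z (g - Gm) + stepβ cβ t * inner ℝ z (g' - g) + inner ℝ z δ := by
    simp only [inner_add_right, inner_smul_right, inner_sub_right]
    ring
  have h1 : inner ℝ z (g' - g) ≤ ‖z‖ * (c.LG * (c.B * stepα cα t)) :=
    (real_inner_le_norm _ _).trans (mul_le_mul_of_nonneg_left hG (norm_nonneg _))
  have h2 : inner ℝ z δ ≤ ‖z‖ * (c.Lω * (c.B * stepα cα t)) :=
    (real_inner_le_norm _ _).trans (mul_le_mul_of_nonneg_left hδ (norm_nonneg _))
  have h3 : ‖stepβ cβ t • g' + δ‖ ≤ stepβ cβ t * c.B + c.Lω * (c.B * stepα cα t) := by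
    refine (norm_add_le _ _).trans (add_le_add ?_ hδ)
    rw [norm_smul, Real.norm_of_nonneg hβ]
    exact mul_le_mul_of_nonneg_left hg' hβ
  have h4 := pow_le_pow_left₀ (norm_nonneg _) h3 2
  have h5 := mul_le_mul_of_nonneg_left hmono hβ
  have h6 := mul_le_mul_of_nonneg_left h1 hβ
  rw [e1, norm_add_sq_real, e2]
  nlinarith [sq_nonneg (stepβ cβ t * c.B - c.Lω * (c.B * stepα cα t))]

/-- One-step decrease of the mean square tracking error. Half of the contraction that remains after
the strong monotonicity absorbs the motion of the target, and half absorbs the Markovian noise. -/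
theorem drift_z {A D : ℝ} (hA : c.B * (1 + c.Lω * (cα / cβ)) ≤ A)
    (hD : C₂ c cα cβ + 2 * c.B * (cα / cβ) ≤ D) {s τ : ℕ} (hτ : 1 ≤ τ)
    (hmix : c.m * c.ρ ^ τ ≤ stepα cα (s + τ))
    (hs : D * τ ^ 2 * stepβ cβ s ≤ c.lamG) (hs1 : stepβ cβ s ≤ 1) :
    c.lamG * stepβ cβ (s + τ) * ∫ o, ‖ω (s + τ) o - ωstar (θ (s + τ) o)‖ ^ 2 ∂Pr
      ≤ ∫ o, ‖ω (s + τ) o - ωstar (θ (s + τ) o)‖ ^ 2 ∂Pr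
        - ∫ o, ‖ω (s + τ + 1) o - ωstar (θ (s + τ + 1) o)‖ ^ 2 ∂Pr
        + 4 * (D / 2 + A * c.lamG + 2 * c.B * A + 2 * c.B ^ 2) * τ ^ 2
          * (stepβ cβ (s + τ) * stepβ cβ s)
        + 4 * (c.LG ^ 2 + c.Lω ^ 2 * (1 + c.lamG)) * c.B ^ 2 * stepα cα (s + τ) ^ 2
          / (c.lamG * stepβ cβ (s + τ)) := by
  have := h.prob
  have hκ0 := (div_pos h.cα_pos h.cβ_pos).le
  have hB := h.valid.B_pos.le
  have hLω := h.valid.Lω_nonneg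
  have hLG := h.valid.LG_nonneg
  have hlam := h.valid.lamG_pos
  have hτ' : (1 : ℝ) ≤ τ := by exact_mod_cast hτ
  have hN := h.trackingNoise_le hA hD hτ hmix
  have hint := integral_le_of_ae_le_linear (h.integrable_norm_z_sq (s + τ + 1))
    (h.integrable_norm_z_sq (s + τ)) (h.integrable_norm_z (s + τ))
    (h.integrable_inner_z_G (s + τ) (s + τ) (s + τ))
    (h.G_bdd.mono fun o ho => h.norm_z_succ_sq_le ho (s + τ))
  have hZs : ∫ o, ‖ω s o - ωstar (θ s o)‖ ∂Pr
      ≤ ∫ o, ‖ω (s + τ) o - ωstar (θ (s + τ) o)‖ ∂Pr + A * stepβ cβ s * τ := by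
    have h1 := integral_le_of_ae_le_linear (h.integrable_norm_z s)
      (h.integrable_norm_z (s + τ)) (integrable_zero _ _ _) (integrable_zero _ _ _)
      (p := 1) (q := 0) (w := 0) (k := A * stepβ cβ s * τ)
      (h.G_bdd.mono fun o ho => by linarith [h.norm_z_le ho hA s τ])
    linarith
  have hJ : (∫ o, ‖ω (s + τ) o - ωstar (θ (s + τ) o)‖ ∂Pr) ^ 2
      ≤ ∫ o, ‖ω (s + τ) o - ωstar (θ (s + τ) o)‖ ^ 2 ∂Pr := by
    set Z := ∫ o, ‖ω (s + τ) o - ωstar (θ (s + τ) o)‖ ∂Pr with hZ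
    have h1 := integral_mono
      (((h.integrable_norm_z (s + τ)).const_mul (2 * Z)).sub (integrable_const (Z ^ 2)))
      (h.integrable_norm_z_sq (s + τ))
      (fun o => by
        simp only [Pi.sub_apply]
        nlinarith [sq_nonneg (‖ω (s + τ) o - ωstar (θ (s + τ) o)‖ - Z)])
    simp only [Pi.sub_apply] at h1
    rw [integral_sub ((h.integrable_norm_z (s + τ)).const_mul (2 * Z)) (integrable_const (Z ^ 2)),
      integral_const_mul, integral_const, probReal_univ, one_smul, ← hZ] at h1
    linarith
  have hβs := stepβ_pos h.cβ_pos s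
  have hβ := stepβ_pos h.cβ_pos (s + τ)
  have hβle := stepβ_antitone h.cβ_pos (Nat.le_add_right s τ)
  have hα := (stepα_pos h.cα_pos (s + τ)).le
  have hA0 : 0 ≤ A := le_trans (by positivity) hA
  have hD0 : 0 ≤ D := by
    refine le_trans ?_ hD
    have := h.valid.LTV_nonneg; have := h.valid.Lμ_nonneg
    have := h.cα_pos; have := h.cβ_pos
    unfold C₂
    positivity
  exact drift_of_noise_le hB hA0 hD0 hlam hτ' hβs hβ hβle hs1 hs hint hN hZs hJ

/-! ### Descent of the objective -/

/-- Descent of the objective along a path: half of the gradient term absorbs the error made by using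
`ω_t` instead of `ωstar θ_t`. -/
theorem f_succ_sub_le (t : ℕ) (o : Ω) :
    f (θ (t + 1) o) - f (θ t o) ≤
      -(stepα cα t / 2) * ‖gradient f (θ t o)‖ ^ 2
      + c.LF ^ 2 * stepα cα t / 2 * ‖ω t o - ωstar (θ t o)‖ ^ 2
      + -stepα cα t * (inner ℝ (gradient f (θ t o)) (F (θ t o) (ωstar (θ t o)) (X t o))
          - ‖gradient f (θ t o)‖ ^ 2)
      + c.Lf * c.B ^ 2 * stepα cα t ^ 2 / 2 := by
  have hα := (stepα_pos h.cα_pos t).le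
  have hq := le_quadratic_of_gradient_lipschitz h.data.f_diff h.data.f_smooth (θ t o)
    (-(stepα cα t • F (θ t o) (ω t o) (X t o)))
  rw [← sub_eq_add_neg, ← h.θ_succ, norm_neg, norm_smul, mul_pow, Real.norm_of_nonneg hα,
    inner_neg_right, inner_smul_right] at hq
  have hF := h.data.F_bdd (θ t o) (ω t o) (X t o)
  have hl := h.data.F_lip (θ t o) (θ t o) (ωstar (θ t o)) (ω t o) (X t o)
  rw [sub_self, norm_zero, zero_add, norm_sub_rev (ωstar _)] at hl
  set F₁ := F (θ t o) (ω t o) (X t o)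
  set F₀ := F (θ t o) (ωstar (θ t o)) (X t o)
  set D := gradient f (θ t o)
  set z := ω t o - ωstar (θ t o)
  have h1 : inner ℝ D (F₀ - F₁) ≤ ‖D‖ * (c.LF * ‖z‖) :=
    (real_inner_le_norm _ _).trans (mul_le_mul_of_nonneg_left hl (norm_nonneg _))
  have h2 : inner ℝ D (F₀ - F₁) ≤ ‖D‖ ^ 2 / 2 + c.LF ^ 2 * ‖z‖ ^ 2 / 2 := by
    linarith [sq_nonneg (‖D‖ - c.LF * ‖z‖)]
  rw [inner_sub_right] at h2
  have h3 := mul_le_mul_of_nonneg_left h2 hα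
  have h4 : c.Lf / 2 * (stepα cα t ^ 2 * ‖F₁‖ ^ 2) ≤ c.Lf / 2 * (stepα cα t ^ 2 * c.B ^ 2) := by
    have := h.valid.Lf_nonneg
    gcongr
  linarith

theorem drift_f {s τ : ℕ} (hτ : 1 ≤ τ) (hmix : c.m * c.ρ ^ τ ≤ stepα cα (s + τ)) :
    stepα cα (s + τ) * ∫ o, ‖gradient f (θ (s + τ) o)‖ ^ 2 ∂Pr
      ≤ 2 * (∫ o, f (θ (s + τ) o) ∂Pr - ∫ o, f (θ (s + τ + 1) o) ∂Pr)
        + 2 * (2 * C₁ c * c.B * τ ^ 2 + 2 * c.B ^ 2) * (stepα cα (s + τ) * stepα cα s)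
        + c.Lf * c.B ^ 2 * stepα cα (s + τ) ^ 2
        + c.LF ^ 2 * (stepα cα (s + τ) * ∫ o, ‖ω (s + τ) o - ωstar (θ (s + τ) o)‖ ^ 2 ∂Pr) := by
  have := h.prob
  have hα := (stepα_pos h.cα_pos (s + τ)).le
  have hN := (neg_le_abs _).trans (h.abs_gradientNoise_le hτ hmix)
  have hint := integral_le_of_ae_le_linear
    ((h.integrable_f (s + τ + 1)).sub (h.integrable_f (s + τ)))
    (h.integrable_norm_gradient_sq (s + τ)) (h.integrable_norm_z_sq (s + τ))
    ((h.integrable_inner_gradient_F (s + τ) (s + τ)).sub (h.integrable_norm_gradient_sq (s + τ)))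
    (ae_of_all _ (h.f_succ_sub_le (s + τ)))
  simp only [Pi.sub_apply] at hint
  rw [integral_sub (h.integrable_f (s + τ + 1)) (h.integrable_f (s + τ))] at hint
  have h1 := mul_le_mul_of_nonneg_left hN hα
  linarith

/-! ### Summation -/

/-- Weighted sum of the mean square tracking errors over `N` steps from time `a`. The mixing times
are at most `a`, so the noise at time `a + j` is governed by the step sizes at time `j`. -/
theorem sum_z_le {A D : ℝ} (hA : c.B * (1 + c.Lω * (cα / cβ)) ≤ A)
    (hD : C₂ c cα cβ + 2 * c.B * (cα / cβ) ≤ D) {a N : ℕ}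
    (hT : ∀ j < N, mixTime c cα (a + j) ≤ a)
    (hs : ∀ j < N, D * (mixTime c cα (a + j) : ℝ) ^ 2
      * stepβ cβ (a + j - mixTime c cα (a + j)) ≤ c.lamG ∧
        stepβ cβ (a + j - mixTime c cα (a + j)) ≤ 1) :
    ∑ j ∈ Finset.range N, stepα cα (a + j)
        * ∫ o, ‖ω (a + j) o - ωstar (θ (a + j) o)‖ ^ 2 ∂Pr
      ≤ cα / (c.lamG * cβ) * ∫ o, ‖ω a o - ωstar (θ a o)‖ ^ 2 ∂Pr
        + (4 * (c.LG ^ 2 + c.Lω ^ 2 * (1 + c.lamG)) * c.B ^ 2 / c.lamG ^ 2 * (cα ^ 3 / cβ ^ 2)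
          + 4 * (D / 2 + A * c.lamG + 2 * c.B * A + 2 * c.B ^ 2) / c.lamG * (cα * cβ)
            * (a : ℝ) ^ 2) * (Real.log ((N : ℝ) + 1) / Real.log 2) := by
  have hκ0 := (div_pos h.cα_pos h.cβ_pos).le
  have hcα := h.cα_pos
  have hcβ := h.cβ_pos
  have hB := h.valid.B_pos.le
  have hLω := h.valid.Lω_nonneg
  have hLG := h.valid.LG_nonneg
  have hlam := h.valid.lamG_pos
  have hA0 : 0 ≤ A := le_trans (by positivity) hA
  have hD0 : 0 ≤ D := by
    refine le_trans ?_ hD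
    have := h.valid.LTV_nonneg; have := h.valid.Lμ_nonneg
    unfold C₂
    positivity
  set V : ℕ → ℝ := fun t => ∫ o, ‖ω t o - ωstar (θ t o)‖ ^ 2 ∂Pr with hV
  have hV0 : ∀ t, 0 ≤ V t := fun t => integral_nonneg fun o => by positivity
  set w : ℕ → ℝ := fun t => 1 / c.lamG * (stepα cα t / stepβ cβ t) with hw
  have hw0 : ∀ t, 0 ≤ w t := fun t => by
    have := stepα_pos hcα t; have := stepβ_pos hcβ t
    positivity
  have hwa : Antitone w := fun i j hij =>
    mul_le_mul_of_nonneg_left (stepα_div_stepβ_antitone hcα hcβ hij) (by positivity)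
  set K := D / 2 + A * c.lamG + 2 * c.B * A + 2 * c.B ^ 2 with hK
  have hK0 : 0 ≤ K := by positivity
  set R := 4 * (c.LG ^ 2 + c.Lω ^ 2 * (1 + c.lamG)) * c.B ^ 2 / c.lamG ^ 2 * (cα ^ 3 / cβ ^ 2)
    + 4 * K / c.lamG * (cα * cβ) * (a : ℝ) ^ 2 with hR
  have hR0 : 0 ≤ R := by positivity
  have hterm : ∀ j ∈ Finset.range N, stepα cα (a + j) * V (a + j)
      ≤ w (a + j) * (V (a + j) - V (a + j + 1)) + R * (1 / ((j : ℝ) + 1)) := by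
    intro j hj
    have hj' := Finset.mem_range.1 hj
    obtain ⟨hm1, hm2⟩ := mixTime_spec h.valid hcα (a + j)
    have hTj := hT j hj'
    have hsj := hs j hj'
    -- `s` is one mixing time before `a + j`, and `j ≤ s`
    obtain ⟨s, hst⟩ : ∃ s, a + j = s + mixTime c cα (a + j) :=
      ⟨a + j - mixTime c cα (a + j), by omega⟩
    rw [show a + j - mixTime c cα (a + j) = s by omega] at hsj
    have hd := h.drift_z hA hD (s := s) hm1 (by rw [← hst]; exact hm2) hsj.1 hsj.2
    rw [← hst] at hd
    change c.lamG * stepβ cβ (a + j) * V (a + j) ≤ V (a + j) - V (a + j + 1) + _ + _ at hd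
    have hjs : j ≤ s := by omega
    have hα := stepα_pos hcα (a + j)
    have hβ := stepβ_pos hcβ (a + j)
    have hd' := mul_le_mul_of_nonneg_left hd (hw0 (a + j))
    have e1 : w (a + j) * (c.lamG * stepβ cβ (a + j) * V (a + j))
        = stepα cα (a + j) * V (a + j) := by
      simp only [hw]
      field_simp
    have e2 : w (a + j) * (4 * K * (mixTime c cα (a + j) : ℝ) ^ 2
          * (stepβ cβ (a + j) * stepβ cβ s))
        = 4 * K / c.lamG * (mixTime c cα (a + j) : ℝ) ^ 2 * (stepα cα (a + j) * stepβ cβ s) := by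
      simp only [hw]
      field_simp
    have e3 : w (a + j) * (4 * (c.LG ^ 2 + c.Lω ^ 2 * (1 + c.lamG)) * c.B ^ 2
          * stepα cα (a + j) ^ 2 / (c.lamG * stepβ cβ (a + j)))
        = 4 * (c.LG ^ 2 + c.Lω ^ 2 * (1 + c.lamG)) * c.B ^ 2 / c.lamG ^ 2
          * (stepα cα (a + j) ^ 3 / stepβ cβ (a + j) ^ 2) := by
      simp only [hw]
      field_simp
    have b2 : stepα cα (a + j) * stepβ cβ s ≤ cα * cβ * (1 / ((j : ℝ) + 1)) := by
      rw [← stepα_mul_stepβ]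
      exact mul_le_mul (stepα_antitone hcα (Nat.le_add_left j a)) (stepβ_antitone hcβ hjs)
        (stepβ_pos hcβ s).le (stepα_pos hcα j).le
    have hTj' : (mixTime c cα (a + j) : ℝ) ≤ a := by exact_mod_cast hTj
    have b3 : stepα cα (a + j) ^ 3 / stepβ cβ (a + j) ^ 2
        ≤ cα ^ 3 / cβ ^ 2 * (1 / ((j : ℝ) + 1)) := by
      rw [stepα_pow_div_stepβ_pow]
      push_cast
      gcongr
      linarith [(Nat.cast_nonneg a : (0 : ℝ) ≤ a)]
    have c2 : 4 * K / c.lamG * (mixTime c cα (a + j) : ℝ) ^ 2 * (stepα cα (a + j) * stepβ cβ s)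
        ≤ 4 * K / c.lamG * (a : ℝ) ^ 2 * (cα * cβ * (1 / ((j : ℝ) + 1))) := by
      have := stepβ_pos hcβ s
      gcongr
    have c3 := mul_le_mul_of_nonneg_left b3 (by positivity :
      0 ≤ 4 * (c.LG ^ 2 + c.Lω ^ 2 * (1 + c.lamG)) * c.B ^ 2 / c.lamG ^ 2)
    rw [mul_add, mul_add, e1, e2, e3] at hd'
    rw [hR]
    linarith
  have hsum := Finset.sum_le_sum hterm
  rw [Finset.sum_add_distrib, ← Finset.mul_sum] at hsum
  have habel := sum_mul_sub_le hwa hw0 hV0 a N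
  have hlog := mul_le_mul_of_nonneg_left (sum_inv_le_log_div_log_two N) hR0
  have hwle : w a * V a ≤ cα / (c.lamG * cβ) * V a := by
    refine mul_le_mul_of_nonneg_right ?_ (hV0 a)
    have : cα / (c.lamG * cβ) = w 0 := by
      simp [hw, stepα, stepβ]
      field_simp
    rw [this]
    exact hwa (Nat.zero_le a)
  linarith

/-- Weighted sum of the mean square gradients over `N` steps from time `a`. -/
theorem sum_gradient_le {a N : ℕ} (hT : ∀ j < N, mixTime c cα (a + j) ≤ a) :
    ∑ j ∈ Finset.range N, stepα cα (a + j) * ∫ o, ‖gradient f (θ (a + j) o)‖ ^ 2 ∂Pr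
      ≤ 2 * ∫ o, (f (θ a o) - ⨅ u, f u) ∂Pr
        + 6 * (2 * (2 * C₁ c * c.B * (a : ℝ) ^ 2 + 2 * c.B ^ 2) + c.Lf * c.B ^ 2) * cα ^ 2
        + c.LF ^ 2 * ∑ j ∈ Finset.range N, stepα cα (a + j)
          * ∫ o, ‖ω (a + j) o - ωstar (θ (a + j) o)‖ ^ 2 ∂Pr := by
  have := h.prob
  have hcα := h.cα_pos
  have hB := h.valid.B_pos.le
  have hLf := h.valid.Lf_nonneg
  have hC₁ : 0 ≤ C₁ c := by
    have := h.valid.LTV_nonneg; have := h.valid.Lμ_nonneg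
    have := h.valid.LF_nonneg; have := h.valid.Lω_nonneg
    unfold C₁
    positivity
  set K := 2 * (2 * C₁ c * c.B * (a : ℝ) ^ 2 + 2 * c.B ^ 2) + c.Lf * c.B ^ 2 with hK
  have hK0 : 0 ≤ K := by positivity
  have hterm : ∀ j ∈ Finset.range N,
      stepα cα (a + j) * ∫ o, ‖gradient f (θ (a + j) o)‖ ^ 2 ∂Pr
      ≤ 2 * (∫ o, f (θ (a + j) o) ∂Pr - ∫ o, f (θ (a + (j + 1)) o) ∂Pr)
        + K * cα ^ 2 * ((j : ℝ) + 1) ^ (-(6 / 5) : ℝ)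
        + c.LF ^ 2 * (stepα cα (a + j)
          * ∫ o, ‖ω (a + j) o - ωstar (θ (a + j) o)‖ ^ 2 ∂Pr) := by
    intro j hj
    have hj' := Finset.mem_range.1 hj
    obtain ⟨hm1, hm2⟩ := mixTime_spec h.valid hcα (a + j)
    have hTj := hT j hj'
    obtain ⟨s, hst⟩ : ∃ s, a + j = s + mixTime c cα (a + j) :=
      ⟨a + j - mixTime c cα (a + j), by omega⟩
    have hd := h.drift_f (s := s) hm1 (by rw [← hst]; exact hm2)
    rw [← hst] at hd
    have hjs : j ≤ s := by omega
    have hα := stepα_pos hcα (a + j)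
    have hαs := stepα_pos hcα s
    have hα0 := (stepα_pos hcα j).le
    have hαj := stepα_antitone hcα (Nat.le_add_left j a)
    have hαsj := stepα_antitone hcα hjs
    have hTj' : (mixTime c cα (a + j) : ℝ) ≤ a := by exact_mod_cast hTj
    have b1 : 2 * (2 * C₁ c * c.B * (mixTime c cα (a + j) : ℝ) ^ 2 + 2 * c.B ^ 2)
          * (stepα cα (a + j) * stepα cα s)
        ≤ 2 * (2 * C₁ c * c.B * (a : ℝ) ^ 2 + 2 * c.B ^ 2) * (stepα cα j * stepα cα j) := by
      gcongr
    have b2 : c.Lf * c.B ^ 2 * stepα cα (a + j) ^ 2 ≤ c.Lf * c.B ^ 2 * stepα cα j ^ 2 := by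
      gcongr
    have e : K * cα ^ 2 * ((j : ℝ) + 1) ^ (-(6 / 5) : ℝ) = K * stepα cα j ^ 2 := by
      rw [stepα_sq]; ring
    rw [e, hK, ← add_assoc]
    linarith
  have hsum := Finset.sum_le_sum hterm
  rw [Finset.sum_add_distrib, Finset.sum_add_distrib, ← Finset.mul_sum, ← Finset.mul_sum,
    ← Finset.mul_sum, Finset.sum_range_sub' (fun j => ∫ o, f (θ (a + j) o) ∂Pr)] at hsum
  have h1 := mul_le_mul_of_nonneg_left (sum_rpow_neg_le N) (by positivity : 0 ≤ K * cα ^ 2)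
  have h2 : ⨅ u, f u ≤ ∫ o, f (θ (a + N) o) ∂Pr := by
    have := integral_mono (integrable_const (⨅ u, f u)) (h.integrable_f (a + N))
      (fun o => ciInf_le h.data.f_bdd (θ (a + N) o))
    simpa using this
  have h3 : ∫ o, (f (θ a o) - ⨅ u, f u) ∂Pr = ∫ o, f (θ a o) ∂Pr - ⨅ u, f u := by
    rw [integral_sub (h.integrable_f a) (integrable_const _)]
    simp
  rw [add_zero] at hsum
  rw [h3]
  linarith

/-! ### Bounds on the smallest gradient -/

/-- The bound on the smallest gradient when the averaging window `[τ_k, k]` is longer than the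
mixing time, so that the step sizes on it sum to the order of `N ^ (2/5)`. -/
theorem minUpTo_mul_le {A D : ℝ} (hA : c.B * (1 + c.Lω * (cα / cβ)) ≤ A)
    (hD : C₂ c cα cβ + 2 * c.B * (cα / cβ) ≤ D) {k N : ℕ}
    (hN : N + mixTime c cα k = k + 1) (hN' : mixTime c cα k + 1 ≤ N)
    (hs : ∀ t, mixTime c cα k ≤ t → t ≤ k →
      D * (mixTime c cα t : ℝ) ^ 2 * stepβ cβ (t - mixTime c cα t) ≤ c.lamG ∧
      stepβ cβ (t - mixTime c cα t) ≤ 1) :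
    minUpTo (fun t => ∫ o, ‖gradient f (θ t o)‖ ^ 2 ∂Pr) k
        * (5 / 2 * cα * Cν * (N : ℝ) ^ (2 / 5 : ℝ))
      ≤ 2 * ∫ o, (f (θ (mixTime c cα k) o) - ⨅ u, f u) ∂Pr
        + 6 * (2 * (2 * C₁ c * c.B * (mixTime c cα k : ℝ) ^ 2 + 2 * c.B ^ 2)
          + c.Lf * c.B ^ 2) * cα ^ 2
        + c.LF ^ 2 * (cα / (c.lamG * cβ)
            * ∫ o, ‖ω (mixTime c cα k) o - ωstar (θ (mixTime c cα k) o)‖ ^ 2 ∂Pr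
          + (4 * (c.LG ^ 2 + c.Lω ^ 2 * (1 + c.lamG)) * c.B ^ 2 / c.lamG ^ 2 * (cα ^ 3 / cβ ^ 2)
            + 4 * (D / 2 + A * c.lamG + 2 * c.B * A + 2 * c.B ^ 2) / c.lamG * (cα * cβ)
              * (mixTime c cα k : ℝ) ^ 2) * (Real.log ((N : ℝ) + 1) / Real.log 2)) := by
  set a := mixTime c cα k with ha
  have hT : ∀ j < N, mixTime c cα (a + j) ≤ a := fun j hj =>
    mixTime_mono h.valid h.cα_pos (by omega : a + j ≤ k)
  have h1 := h.sum_z_le hA hD hT fun j hj => hs (a + j) (by omega) (by omega)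
  have h2 := h.sum_gradient_le hT
  have h3 := minUpTo_mul_sum_le (g := fun t => ∫ o, ‖gradient f (θ t o)‖ ^ 2 ∂Pr)
    (fun t => (stepα_pos h.cα_pos t).le) (by omega : a + N ≤ k + 1)
  have h0 : 0 ≤ minUpTo (fun t => ∫ o, ‖gradient f (θ t o)‖ ^ 2 ∂Pr) k :=
    minUpTo_nonneg (fun t => integral_nonneg fun o => by positivity) k
  have h4 := mul_le_mul_of_nonneg_left (sum_stepα_ge h.cα_pos hN') h0
  have h5 := mul_le_mul_of_nonneg_left h1 (sq_nonneg c.LF)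
  linarith

theorem integral_gap_nonneg (t : ℕ) : 0 ≤ ∫ o, (f (θ t o) - ⨅ u, f u) ∂Pr :=
  integral_nonneg fun _ => sub_nonneg.2 (ciInf_le h.data.f_bdd _)

/-- When the window `[τ_k, k]` is not longer than the mixing time, the explicit bound already
dominates the gradient at time `τ_k`: a gradient step of length `cα * N ^ (2/5)` bounds the gap from
below if `Lf` is small, and otherwise the `C₁` term exceeds `B ^ 2`. -/
theorem integral_gradient_le_explicitBound {a : ℕ} {N : ℝ} (hN : 1 ≤ N) (hNa : N ≤ a) :
    ∫ o, ‖gradient f (θ a o)‖ ^ 2 ∂Pr ≤ explicitBound c cα cβ a N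
      (∫ o, (f (θ a o) - ⨅ u, f u) ∂Pr) (∫ o, ‖ω a o - ωstar (θ a o)‖ ^ 2 ∂Pr) := by
  have := h.prob
  have hcα := h.cα_pos
  have hcβ := h.cβ_pos
  have hB := h.valid.B_pos
  have hLf := h.valid.Lf_nonneg
  have hlam := h.valid.lamG_pos
  have hC₁ := C₁_nonneg h.valid
  have hC₃ := C₃_nonneg h.valid hcα hcβ
  have hCν := Cν_pos
  have hgap := h.integral_gap_nonneg a
  have herr : 0 ≤ ∫ o, ‖ω a o - ωstar (θ a o)‖ ^ 2 ∂Pr := integral_nonneg fun o => by positivity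
  have hlog : 0 ≤ Real.log (N + 1) / Real.log 2 :=
    div_nonneg (Real.log_nonneg (by linarith)) (Real.log_nonneg (by norm_num))
  set x := N ^ (2 / 5 : ℝ) with hx
  have hx1 : 1 ≤ x := Real.one_le_rpow hN (by norm_num)
  have hx0 : 0 < x := by linarith
  have hxN : x ^ 2 ≤ (a : ℝ) ^ 2 := by
    have : x ≤ N := by
      have := Real.rpow_le_rpow_of_exponent_le hN (by norm_num : (2 / 5 : ℝ) ≤ 1)
      rwa [Real.rpow_one] at this
    exact pow_le_pow_left₀ hx0.le (this.trans hNa) 2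
  have hmid : 0 ≤ 4 * c.LF ^ 2 / (5 * cα * Cν * x) *
    (2 * cα / (c.lamG * cβ) * (∫ o, ‖ω a o - ωstar (θ a o)‖ ^ 2 ∂Pr)
      + ((2 * c.LG ^ 2 * c.B ^ 2 / c.lamG ^ 2 + 2 * c.Lω ^ 2 * c.B ^ 2 / c.lamG ^ 2
            + 2 * c.Lω ^ 2 * c.B ^ 2 / c.lamG) * (cα ^ 3 / cβ ^ 2)
          + 2 * C₃ c cα cβ * cα * cβ / c.lamG * (a : ℝ) ^ 2)
        * (Real.log (N + 1) / Real.log 2)) := by positivity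
  have hfirst : 0 ≤ 4 / (5 * cα * Cν * x) * ∫ o, (f (θ a o) - ⨅ u, f u) ∂Pr := by positivity
  have hlast : 0 ≤ 6 * (4 * C₁ c * c.B * (a : ℝ) ^ 2 + 8 * c.B ^ 2 + 2 * c.Lf * c.B ^ 2) * cα
    / (Cν * x) := by positivity
  unfold explicitBound
  rw [← hx]
  by_cases hsmall : c.Lf * (cα * x) ≤ 1
  · have hg : cα * x / 2 * ∫ o, ‖gradient f (θ a o)‖ ^ 2 ∂Pr
        ≤ ∫ o, (f (θ a o) - ⨅ u, f u) ∂Pr := by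
      rw [← integral_const_mul]
      refine integral_mono ((h.integrable_norm_gradient_sq a).const_mul _)
        ((h.integrable_f a).sub (integrable_const _)) fun o => ?_
      have h1 := mul_norm_gradient_sq_le_gap h.data.f_diff h.data.f_bdd h.data.f_smooth (θ a o)
        (cα * x)
      refine le_trans ?_ h1
      have h2 : cα * x / 2 ≤ cα * x * (1 - c.Lf * (cα * x) / 2) := by
        have : 0 < cα * x := by positivity
        nlinarith
      exact mul_le_mul_of_nonneg_right h2 (by positivity)
    have h1 := mul_le_mul_of_nonneg_left hg (by positivity : 0 ≤ 4 / (5 * cα * Cν * x))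
    have e : ∀ g : ℝ, 4 / (5 * cα * Cν * x) * (cα * x / 2 * g) = 2 / (5 * Cν) * g := fun g => by
      field_simp
      ring
    rw [e] at h1
    have h2 : 1 ≤ 2 / (5 * Cν) := by
      rw [le_div_iff₀ (by positivity)]
      linarith [Cν_le]
    have h3 : 0 ≤ ∫ o, ‖gradient f (θ a o)‖ ^ 2 ∂Pr := integral_nonneg fun o => by positivity
    linarith [le_mul_of_one_le_left h3 h2]
  · have hg : ∫ o, ‖gradient f (θ a o)‖ ^ 2 ∂Pr ≤ c.B ^ 2 := by
      have := integral_mono (h.integrable_norm_gradient_sq a) (integrable_const (c.B ^ 2))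
        (fun o => pow_le_pow_left₀ (norm_nonneg _) (h.data.norm_gradient_le (θ a o)) 2)
      simpa using this
    have hbig : c.B ^ 2 ≤ 6 * (4 * C₁ c * c.B * (a : ℝ) ^ 2 + 8 * c.B ^ 2 + 2 * c.Lf * c.B ^ 2) * cα
        / (Cν * x) := by
      have hC : 2 * c.B * c.Lf ≤ C₁ c := by
        have := h.valid.LF_nonneg; have := h.valid.Lω_nonneg
        have := h.valid.LTV_nonneg; have := h.valid.Lμ_nonneg
        have : 0 ≤ 2 * c.B * c.LF * (c.Lω + 1) + 2 * c.B ^ 2 * c.LTV + 2 * c.B ^ 2 * c.Lμ := by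
          positivity
        unfold C₁
        linarith
      rw [le_div_iff₀ (by positivity)]
      push Not at hsmall
      have h1 : c.B ^ 2 * (Cν * x) ≤ c.B ^ 2 * (1 * x) := by
        have := Cν_le
        gcongr
        linarith
      have h2 : c.B ^ 2 * x ≤ c.B ^ 2 * x * (c.Lf * (cα * x)) :=
        le_mul_of_one_le_right (by positivity) hsmall.le
      have h3 : c.B ^ 2 * c.Lf * cα * x ^ 2 ≤ c.B ^ 2 * c.Lf * cα * (a : ℝ) ^ 2 :=
        mul_le_mul_of_nonneg_left hxN (by positivity)
      have h4 : 6 * (4 * (2 * c.B * c.Lf) * c.B * (a : ℝ) ^ 2) * cα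
          ≤ 6 * (4 * C₁ c * c.B * (a : ℝ) ^ 2) * cα := by gcongr
      have h5 : 0 ≤ 6 * (8 * c.B ^ 2 + 2 * c.Lf * c.B ^ 2) * cα := by positivity
      have h6 : 0 ≤ c.B ^ 2 * c.Lf * cα * (a : ℝ) ^ 2 := by positivity
      linarith
    linarith

theorem minUpTo_le_explicitBound (hαβ : cα ≤ cβ) {k : ℕ} (hk : mixTime c cα k ≤ k)
    (hs : ∀ t, mixTime c cα k ≤ t → t ≤ k → StepCondition c cα cβ t) :
    minUpTo (fun t => ∫ o, ‖gradient f (θ t o)‖ ^ 2 ∂Pr) k ≤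
      explicitBound c cα cβ (mixTime c cα k) ((k : ℝ) - mixTime c cα k + 1)
        (∫ o, (f (θ (mixTime c cα k) o) - ⨅ u, f u) ∂Pr)
        (∫ o, ‖ω (mixTime c cα k) o - ωstar (θ (mixTime c cα k) o)‖ ^ 2 ∂Pr) := by
  have hcα := h.cα_pos
  have hcβ := h.cβ_pos
  have hB := h.valid.B_pos
  have hLf := h.valid.Lf_nonneg
  have hLω := h.valid.Lω_nonneg
  have hlam := h.valid.lamG_pos
  have hC₁ := C₁_nonneg h.valid
  have hC₂ := C₂_nonneg h.valid hcα hcβ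
  have hC₃ := C₃_nonneg h.valid hcα hcβ
  have hCν := Cν_pos
  obtain ⟨N, hN⟩ : ∃ N, N + mixTime c cα k = k + 1 := ⟨k + 1 - mixTime c cα k, by omega⟩
  have hNr : (k : ℝ) - mixTime c cα k + 1 = N := by
    have : (N : ℝ) + mixTime c cα k = k + 1 := by exact_mod_cast hN
    linarith
  rw [hNr]
  have hN1 : (1 : ℝ) ≤ N := by exact_mod_cast (by omega : 1 ≤ N)
  rcases Nat.lt_or_ge (mixTime c cα k) N with hlt | hge
  · -- as `cα / cβ ≤ 1`, the ratio can be dropped from both majorants, which gives `C₃` below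
    have hκ : cα / cβ ≤ 1 := (div_le_one hcβ).2 hαβ
    have hA : c.B * (1 + c.Lω * (cα / cβ)) ≤ c.B * (c.Lω + 1) := by
      refine mul_le_mul_of_nonneg_left ?_ hB.le
      linarith [mul_le_mul_of_nonneg_left hκ hLω]
    have hD : C₂ c cα cβ + 2 * c.B * (cα / cβ) ≤ C₂ c cα cβ + 2 * c.B := by
      have := mul_le_mul_of_nonneg_left hκ (by positivity : 0 ≤ 2 * c.B)
      linarith
    have hmain := h.minUpTo_mul_le hA hD hN hlt fun t h1 h2 => by
      obtain ⟨h3, h4⟩ := hs t h1 h2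
      refine ⟨?_, h4⟩
      rw [le_div_iff₀' (by positivity)] at h3
      linarith
    have hgap := h.integral_gap_nonneg (mixTime c cα k)
    have herr : 0 ≤ ∫ o, ‖ω (mixTime c cα k) o - ωstar (θ (mixTime c cα k) o)‖ ^ 2 ∂Pr :=
      integral_nonneg fun o => by positivity
    have hlog : 0 ≤ Real.log ((N : ℝ) + 1) / Real.log 2 :=
      div_nonneg (Real.log_nonneg (by linarith)) (Real.log_nonneg (by norm_num))
    unfold explicitBound
    generalize (∫ o, (f (θ (mixTime c cα k) o) - ⨅ u, f u) ∂Pr) = gap at *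
    generalize (∫ o, ‖ω (mixTime c cα k) o - ωstar (θ (mixTime c cα k) o)‖ ^ 2 ∂Pr) = err at *
    generalize Real.log ((N : ℝ) + 1) / Real.log 2 = ℓ at *
    generalize (mixTime c cα k : ℝ) = T at *
    have hx0 : 0 < (N : ℝ) ^ (2 / 5 : ℝ) := by positivity
    generalize (N : ℝ) ^ (2 / 5 : ℝ) = x at *
    have hy : 0 < 5 / 2 * cα * Cν * x := by positivity
    -- both sides times the lower bound for the sum of the step sizes
    rw [← mul_le_mul_iff_left₀ hy]
    refine hmain.trans ?_
    have e1 : (4 / (5 * cα * Cν * x) * gap + 4 * c.LF ^ 2 / (5 * cα * Cν * x) *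
        (2 * cα / (c.lamG * cβ) * err
          + ((2 * c.LG ^ 2 * c.B ^ 2 / c.lamG ^ 2 + 2 * c.Lω ^ 2 * c.B ^ 2 / c.lamG ^ 2
              + 2 * c.Lω ^ 2 * c.B ^ 2 / c.lamG) * (cα ^ 3 / cβ ^ 2)
            + 2 * C₃ c cα cβ * cα * cβ / c.lamG * T ^ 2) * ℓ)
        + 6 * (4 * C₁ c * c.B * T ^ 2 + 8 * c.B ^ 2 + 2 * c.Lf * c.B ^ 2) * cα / (Cν * x))
          * (5 / 2 * cα * Cν * x)
        = 2 * gap + c.LF ^ 2 * (4 * (cα / (c.lamG * cβ)) * err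
          + (4 * (c.LG ^ 2 + c.Lω ^ 2 * (1 + c.lamG)) * c.B ^ 2 / c.lamG ^ 2 * (cα ^ 3 / cβ ^ 2)
            + 4 * C₃ c cα cβ / c.lamG * (cα * cβ) * T ^ 2) * ℓ)
          + 15 * (4 * C₁ c * c.B * T ^ 2 + 8 * c.B ^ 2 + 2 * c.Lf * c.B ^ 2) * cα ^ 2 := by
      field_simp
      ring
    have e2 : (C₂ c cα cβ + 2 * c.B) / 2 + c.B * (c.Lω + 1) * c.lamG
        + 2 * c.B * (c.B * (c.Lω + 1)) + 2 * c.B ^ 2 = C₃ c cα cβ := by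
      unfold C₃
      ring
    rw [e1, e2]
    have b1 : cα / (c.lamG * cβ) * err ≤ 4 * (cα / (c.lamG * cβ)) * err := by
      have : 0 ≤ cα / (c.lamG * cβ) * err := by positivity
      linarith
    have b2 := mul_le_mul_of_nonneg_left b1 (sq_nonneg c.LF)
    have b3 : 0 ≤ C₁ c * c.B * T ^ 2 * cα ^ 2 := by positivity
    have b4 : 0 ≤ c.B ^ 2 * cα ^ 2 := by positivity
    have b5 : 0 ≤ c.Lf * c.B ^ 2 * cα ^ 2 := by positivity
    linarith
  · refine (minUpTo_le _ hk).trans (h.integral_gradient_le_explicitBound hN1 ?_)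
    exact_mod_cast hge

/-- The rate. The gap and the squared tracking error at time `τ_k` grow at most like `τ_k ^ 2`, so
they do not affect the order of the bound. -/
theorem isBigO_minUpTo :
    (fun k : ℕ => minUpTo (fun t => ∫ o, ‖gradient f (θ t o)‖ ^ 2 ∂Pr) k) =O[atTop]
      (fun k : ℕ => (mixTime c cα k : ℝ) ^ 2 * Real.log k /
        ((k : ℝ) - mixTime c cα k + 1) ^ (2 / 5 : ℝ)) := by
  have := h.prob
  have hcα := h.cα_pos
  have hcβ := h.cβ_pos
  have hB := h.valid.B_pos
  have hLf := h.valid.Lf_nonneg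
  have hLω := h.valid.Lω_nonneg
  have hlam := h.valid.lamG_pos
  have hC₁ := C₁_nonneg h.valid
  have hC₂ := C₂_nonneg h.valid hcα hcβ
  have hCν := Cν_pos
  have hκ := div_pos hcα hcβ
  obtain ⟨R, hR0, hR⟩ := h.exists_norm_z_le
  obtain ⟨Q, hQ0, hQ⟩ := h.exists_abs_f_le
  set A := c.B * (1 + c.Lω * (cα / cβ)) with hA
  set D := C₂ c cα cβ + 2 * c.B * (cα / cβ) with hD
  have hA0 : 0 < A := by positivity
  have hD0 : 0 < D := by positivity
  set I := ⨅ u, f u with hI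
  set K₁ := 2 * (2 * Q + |I|) with hK₁
  set K₂ := 6 * (2 * (2 * C₁ c * c.B + 2 * c.B ^ 2) + c.Lf * c.B ^ 2) * cα ^ 2 with hK₂
  set K₃ := cα / (c.lamG * cβ) * (4 * R ^ 2) with hK₃
  set M₁ := 4 * (c.LG ^ 2 + c.Lω ^ 2 * (1 + c.lamG)) * c.B ^ 2 / c.lamG ^ 2 * (cα ^ 3 / cβ ^ 2)
    with hM₁
  set M₂ := 4 * (D / 2 + A * c.lamG + 2 * c.B * A + 2 * c.B ^ 2) / c.lamG * (cα * cβ) with hM₂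
  have hM₁0 : 0 ≤ M₁ := by positivity
  have hM₂0 : 0 ≤ M₂ := by positivity
  have hlog2 : 0 < Real.log 2 := Real.log_pos (by norm_num)
  set y := 5 / 2 * cα * Cν with hy
  have hy0 : 0 < y := by positivity
  refine IsBigO.of_bound
    ((K₁ + K₂ + c.LF ^ 2 * (K₃ + (M₁ + M₂) * (2 / Real.log 2))) / y) ?_
  filter_upwards [eventually_forall_stepβ_le h.valid hcα hcβ (div_pos hlam hD0),
    eventually_ge_atTop 3] with k hk hk3
  obtain ⟨hk2, hs⟩ := hk
  have hτ1 := (mixTime_spec h.valid hcα k).1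
  obtain ⟨N, hN⟩ : ∃ N, N + mixTime c cα k = k + 1 := ⟨k + 1 - mixTime c cα k, by omega⟩
  have hNr : (k : ℝ) - mixTime c cα k + 1 = N := by
    have : (N : ℝ) + mixTime c cα k = k + 1 := by exact_mod_cast hN
    linarith
  have hmain := h.minUpTo_mul_le le_rfl le_rfl hN (by omega) fun t h1 h2 => by
    obtain ⟨h3, h4⟩ := hs t h1 h2
    refine ⟨?_, h4⟩
    rw [le_div_iff₀' hD0] at h3
    linarith
  have h0 : 0 ≤ minUpTo (fun t => ∫ o, ‖gradient f (θ t o)‖ ^ 2 ∂Pr) k :=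
    minUpTo_nonneg (fun t => integral_nonneg fun o => by positivity) k
  have hT1 : (1 : ℝ) ≤ mixTime c cα k := by exact_mod_cast hτ1
  have hk3' : (3 : ℝ) ≤ k := by exact_mod_cast hk3
  have hlog1 : 1 ≤ Real.log k := by
    rw [Real.le_log_iff_exp_le (by linarith)]
    linarith [Real.exp_one_lt_d9]
  have hℓ : Real.log ((N : ℝ) + 1) / Real.log 2 ≤ 2 / Real.log 2 * Real.log k := by
    have h1 : Real.log ((N : ℝ) + 1) ≤ 2 * Real.log k := by
      have h2 : (N : ℝ) + 1 ≤ (k : ℝ) ^ 2 := by nlinarith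
      refine (Real.log_le_log (by positivity) h2).trans_eq ?_
      rw [Real.log_pow]
      norm_num
    rw [div_mul_eq_mul_div]
    gcongr
  have hgap : ∫ o, (f (θ (mixTime c cα k) o) - I) ∂Pr
      ≤ Q * (mixTime c cα k + 1) + |I| := by
    have h1 := integral_mono ((h.integrable_f (mixTime c cα k)).sub (integrable_const I))
      (integrable_const (Q * (mixTime c cα k + 1) + |I|)) fun o => by
        have h1 := le_of_abs_le (hQ (mixTime c cα k) o)
        have h2 := neg_le_abs I
        simp only [Pi.sub_apply]
        linarith
    simpa using h1
  have herr : ∫ o, ‖ω (mixTime c cα k) o - ωstar (θ (mixTime c cα k) o)‖ ^ 2 ∂Pr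
      ≤ (R * (mixTime c cα k + 1)) ^ 2 := by
    have h1 := integral_mono_ae (h.integrable_norm_z_sq (mixTime c cα k))
      (integrable_const ((R * (mixTime c cα k + 1)) ^ 2))
      (hR.mono fun o ho => pow_le_pow_left₀ (norm_nonneg _) (ho _) 2)
    simpa using h1
  rw [hNr]
  have hx0 : 0 < (N : ℝ) ^ (2 / 5 : ℝ) := by
    have : (0 : ℝ) < N := by exact_mod_cast (by omega : 0 < N)
    positivity
  have hT2 : (1 : ℝ) ≤ (mixTime c cα k : ℝ) ^ 2 := one_le_pow₀ hT1
  rw [Real.norm_of_nonneg h0, Real.norm_of_nonneg (by positivity), div_mul_div_comm,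
    le_div_iff₀ (by positivity)]
  refine hmain.trans ?_
  generalize (mixTime c cα k : ℝ) = T at *
  generalize Real.log (k : ℝ) = L at *
  have hT0 : 0 ≤ T := by linarith
  have hTL : T ^ 2 ≤ T ^ 2 * L := le_mul_of_one_le_right (by positivity) hlog1
  have hTT : T ≤ T ^ 2 := le_self_pow₀ hT1 two_ne_zero
  have g1 : 2 * (Q * (T + 1) + |I|) ≤ K₁ * (T ^ 2 * L) := by
    have e1 : Q * (T + 1) ≤ Q * (2 * (T ^ 2 * L)) := mul_le_mul_of_nonneg_left (by linarith) hQ0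
    have e2 : |I| ≤ |I| * (T ^ 2 * L) :=
      le_mul_of_one_le_right (abs_nonneg I) (hT2.trans hTL)
    rw [hK₁]
    linarith
  have g2 : 6 * (2 * (2 * C₁ c * c.B * T ^ 2 + 2 * c.B ^ 2) + c.Lf * c.B ^ 2) * cα ^ 2
      ≤ K₂ * (T ^ 2 * L) := by
    have e1 := le_mul_of_one_le_right (by positivity : 0 ≤ c.B ^ 2 * cα ^ 2) hT2
    have e2 := le_mul_of_one_le_right (by positivity : 0 ≤ c.Lf * c.B ^ 2 * cα ^ 2) hT2
    have e3 := mul_le_mul_of_nonneg_left hTL (by positivity : 0 ≤ K₂)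
    rw [hK₂] at e3 ⊢
    linarith
  have g3 : cα / (c.lamG * cβ) * (R * (T + 1)) ^ 2 ≤ K₃ * (T ^ 2 * L) := by
    have e1 : (R * (T + 1)) ^ 2 ≤ 4 * R ^ 2 * (T ^ 2 * L) := by
      have : (R * (T + 1)) ^ 2 ≤ (R * (2 * T)) ^ 2 := by gcongr; linarith
      have e2 := mul_le_mul_of_nonneg_left hTL (by positivity : 0 ≤ 4 * R ^ 2)
      linarith
    have e2 := mul_le_mul_of_nonneg_left e1 (by positivity : 0 ≤ cα / (c.lamG * cβ))
    rw [hK₃]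
    linarith
  have g4 : (M₁ + M₂ * T ^ 2) * (Real.log ((N : ℝ) + 1) / Real.log 2)
      ≤ (M₁ + M₂) * (2 / Real.log 2) * (T ^ 2 * L) := by
    have e1 : M₁ + M₂ * T ^ 2 ≤ (M₁ + M₂) * T ^ 2 := by
      linarith [le_mul_of_one_le_right hM₁0 hT2]
    have hℓ0 : 0 ≤ Real.log ((N : ℝ) + 1) / Real.log 2 :=
      div_nonneg (Real.log_nonneg (by linarith [(Nat.cast_nonneg N : (0 : ℝ) ≤ N)])) hlog2.le
    refine (mul_le_mul e1 hℓ hℓ0 (by positivity)).trans_eq ?_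
    ring
  have g5 := mul_le_mul_of_nonneg_left herr (by positivity : 0 ≤ cα / (c.lamG * cβ))
  have g6 := mul_le_mul_of_nonneg_left (add_le_add (g5.trans g3) g4) (sq_nonneg c.LF)
  linarith

end System

end Iterates

end TwoTimeScale

theorem mainTheorem2 {S Ω : Type*} [MeasurableSpace S] {mΩ : MeasurableSpace Ω} {d r : ℕ}
    (c : TwoTimeScale.Constants) (hc : c.Valid)
    (f : TwoTimeScale.E d → ℝ)
    (F : TwoTimeScale.E d → TwoTimeScale.E r → S → TwoTimeScale.E d)
    (G : TwoTimeScale.E d → TwoTimeScale.E r → S → TwoTimeScale.E r)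
    (P : TwoTimeScale.E d → Kernel S S) (π : TwoTimeScale.E d → Measure S)
    (ωstar : TwoTimeScale.E d → TwoTimeScale.E r)
    (hA : TwoTimeScale.Assumptions c f F G P π ωstar)
    (cα cβ : ℝ) (hcα : 0 < cα) (hcβ : 0 < cβ)
    (θ₀ : TwoTimeScale.E d) (ω₀ : TwoTimeScale.E r)
    (Pr : Measure Ω) [IsProbabilityMeasure Pr] (ℱ : Filtration ℕ mΩ) (X : ℕ → Ω → S)
    (θ : ℕ → Ω → TwoTimeScale.E d) (ω : ℕ → Ω → TwoTimeScale.E r)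
    (hθω : ∀ k o, (θ k o, ω k o) =
      TwoTimeScale.iterates F G cα cβ θ₀ ω₀ (fun j => X j o) k)
    (hX : TwoTimeScale.IsControlledChain P Pr ℱ X θ)
    (hG : ∀ k, ∀ᵐ o ∂Pr, ∀ x, ‖G (θ k o) (ω k o) x‖ ≤ c.B ∧ ‖G (θ (k + 1) o) (ω k o) x‖ ≤ c.B) :
    -- all expectations below are those of integrable random variables
    (∀ k, Integrable (fun o => ‖gradient f (θ k o)‖ ^ 2) Pr ∧
      Integrable (fun o => f (θ k o)) Pr ∧
      Integrable (fun o => ‖ω k o - ωstar (θ k o)‖ ^ 2) Pr) ∧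
    -- the explicit bound
    (cα ≤ cβ → ∀ k : ℕ, TwoTimeScale.mixTime c cα k ≤ k →
      (∀ t, TwoTimeScale.mixTime c cα k ≤ t → t ≤ k → TwoTimeScale.StepCondition c cα cβ t) →
      TwoTimeScale.minUpTo (fun t => ∫ o, ‖gradient f (θ t o)‖ ^ 2 ∂Pr) k ≤
        TwoTimeScale.explicitBound c cα cβ (TwoTimeScale.mixTime c cα k)
          ((k : ℝ) - TwoTimeScale.mixTime c cα k + 1)
          (∫ o, (f (θ (TwoTimeScale.mixTime c cα k) o) - ⨅ u, f u) ∂Pr)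
          (∫ o, ‖ω (TwoTimeScale.mixTime c cα k) o
            - ωstar (θ (TwoTimeScale.mixTime c cα k) o)‖ ^ 2 ∂Pr)) ∧
    -- for all step-size constants the step-size condition holds on `[τ_k, k]` for large `k`
    (∀ᶠ k : ℕ in atTop, TwoTimeScale.mixTime c cα k ≤ k ∧
      ∀ t, TwoTimeScale.mixTime c cα k ≤ t → t ≤ k → TwoTimeScale.StepCondition c cα cβ t) ∧
    -- the rate
    (fun k : ℕ => TwoTimeScale.minUpTo (fun t => ∫ o, ‖gradient f (θ t o)‖ ^ 2 ∂Pr) k) =O[atTop]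
      (fun k : ℕ => (TwoTimeScale.mixTime c cα k : ℝ) ^ 2 * Real.log k /
        ((k : ℝ) - TwoTimeScale.mixTime c cα k + 1) ^ (2 / 5 : ℝ)) := by
  have hstep : ∀ k o, (θ (k + 1) o, ω (k + 1) o)
      = (θ k o - TwoTimeScale.stepα cα k • F (θ k o) (ω k o) (X k o),
        ω k o + TwoTimeScale.stepβ cβ k •
          G (θ k o - TwoTimeScale.stepα cα k • F (θ k o) (ω k o) (X k o)) (ω k o) (X k o)) := by
    intro k o
    rw [hθω (k + 1) o, TwoTimeScale.iterates]
    simp only [← hθω k o]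
  have hθ : ∀ k o, θ (k + 1) o
      = θ k o - TwoTimeScale.stepα cα k • F (θ k o) (ω k o) (X k o) :=
    fun k o => congrArg Prod.fst (hstep k o)
  have h : TwoTimeScale.System c f F G P π ωstar cα cβ Pr ℱ X θ ω :=
    { valid := hc
      data := hA
      cα_pos := hcα
      cβ_pos := hcβ
      prob := inferInstance
      chain := hX
      init := ⟨θ₀, ω₀, fun o => congrArg Prod.fst (hθω 0 o), fun o => congrArg Prod.snd (hθω 0 o)⟩
      θ_succ := hθ
      ω_succ := fun k o => by
        rw [hθ k o]
        exact congrArg Prod.snd (hstep k o)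
      G_bdd := ae_all_iff.2 hG }
  refine ⟨fun k => ⟨h.integrable_norm_gradient_sq k, h.integrable_f k, h.integrable_norm_z_sq k⟩,
    fun hαβ k hk hs => h.minUpTo_le_explicitBound hαβ hk hs, ?_, h.isBigO_minUpTo⟩
  have hpos : 0 < c.lamG / (TwoTimeScale.C₂ c cα cβ + 2 * c.B) := by
    have := TwoTimeScale.C₂_nonneg hc hcα hcβ
    have := hc.B_pos
    exact div_pos hc.lamG_pos (by positivity)
  filter_upwards [TwoTimeScale.eventually_forall_stepβ_le hc hcα hcβ hpos] with k hk
  exact ⟨by omega, hk.2⟩
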